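/- Let $q$ be a prime power. Let $GL(n,q)$ be the group of invertible $n\times n$ matrices over $\mathbb F_q$, and let $U(n,q)\subset GL(n,q^2)$ be the group of matrices preserving the standard Hermitian form $\sum_i x_i y_i^q$ on $\mathbb F_{q^2}^n$ (for $n=0$ these groups are trivial). Each group acts on column vectors. For $G\in\{GL,U\}$ and integers $n,k\ge 0$ let $P_{G,n}(k,q)$ be the probability that a uniformly random element $g$ of $G(n,q)$ has a fixed space $\{v: gv=v\}$ of dimension exactly $k$, and let $P_{G,\infty}(k,q)=\lim_{n\to\infty}P_{G,n}(k,q)$. Then for all $n,k\ge 0$ (a sum over $0\le i\le n-k$ being empty if $k>n$): 1. $\displaystyle P_{GL,n}(k,q)=\frac{1}{|GL(k,q)|}\sum_{i=0}^{n-k}\frac{(-1)^i q^{\binom i2}}{q^{ki}\,|GL(i,q)|}$; 2. the limit $P_{GL,\infty}(k,q)$ exists and $\displaystyle P_{GL,\infty}(k,q)=\Big[\prod_{r=1}^{\infty}\Big(1-\frac1{q^r}\Big)\Big]\frac{(1/q)^{k^2}}{(1-\frac1q)^2\cdots(1-\frac1{q^k})^2}$; 3. $\displaystyle P_{U,n}(k,q)=\frac{1}{|U(k,q)|}\sum_{i=0}^{n-k}\frac{(-1)^i(-q)^{\binom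 i2}}{(-q)^{ki}\,|U(i,q)|}$; 4. the limit $P_{U,\infty}(k,q)$ exists and $\displaystyle P_{U,\infty}(k,q)=\Big[\prod_{r=1}^{\infty}\Big(1+\frac1{(-q)^r}\Big)\Big]\frac{(1/q)^{k^2}}{(1-\frac1{q^2})\cdots(1-\frac1{q^{2k}})}$. Both infinite products converge. -/

import Mathlib

open Filter Topology

/-- The dimension of the fixed space `{v | g v = v}` of an invertible matrix `g` acting on column
vectors. -/
noncomputable def fixedDim {F : Type*} [Field F] {n : ℕ} (g : GL (Fin n) F) : ℕ :=
  Module.finrank F (Matrix.mulVecLin (g : Matrix (Fin n) (Fin n) F)).fixedSubmodule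

/-- The probability that a uniformly random element of the (finite) matrix group `G` has a
`k`-dimensional fixed space: the proportion of such elements. -/
noncomputable def fixedProb {F : Type*} [Field F] {n : ℕ} (G : Subgroup (GL (Fin n) F)) (k : ℕ) :
    ℝ :=
  (Nat.card {g : G // fixedDim (g : GL (Fin n) F) = k} : ℝ) / Nat.card G

/-- The standard Hermitian form `⟨x, y⟩ = ∑ xᵢ yᵢ ^ q` on `K ^ n`, for `K` a field with `q ^ 2`
elements (whose involution is `a ↦ a ^ q`). -/
def hermForm (q : ℕ) {K : Type*} [Field K] {n : ℕ} (x y : Fin n → K) : K :=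
  ∑ i, x i * y i ^ q

/-- The unitary group `U(n, q)`, for `K` a field with `q ^ 2` elements: the invertible matrices
that preserve the standard Hermitian form. -/
def unitaryGrp (q : ℕ) (K : Type*) [Field K] (n : ℕ) : Subgroup (GL (Fin n) K) where
  carrier := {g | ∀ x y : Fin n → K,
    hermForm q ((g : Matrix (Fin n) (Fin n) K).mulVec x)
      ((g : Matrix (Fin n) (Fin n) K).mulVec y) = hermForm q x y}
  one_mem' := by
    intro x y
    simp
  mul_mem' := by
    intro g h hg hh x y
    simp only [Units.val_mul, ← Matrix.mulVec_mulVec]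
    rw [hg, hh]
  inv_mem' := by
    intro g hg x y
    rw [← hg]
    simp only [Matrix.mulVec_mulVec, ← Units.val_mul, mul_inv_cancel, Units.val_one,
      Matrix.one_mulVec]

/-!
The sizes of fixed spaces are recovered from averages. Put `X = x ^ d`, where `d` is the dimension
of the fixed space of a random group element, with `x = q` for `GL` and `x = -q` for `U`, and let
`powFalling x X l = (X - 1) (X - x) ⋯ (X - x ^ (l - 1))`. The claim underlying the finite formulas
is that the average of `powFalling x X l` is `ε ^ l` for all `l ≤ n`, with `ε = 1` for `GL` and `ε
= -1` for `U`. The indicator of `d = k` is an explicit combination of the falling products with `l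
≥ k` (`sum_powFalling_eq_ite`, an instance of the `q`-binomial theorem), and averaging this
identity gives `card_eq_of_sum_powFalling`. The group orders also come out as `ε ^ k * powFalling x
(x ^ k) k`.

For `GL` the falling product counts the linearly independent `l`-tuples of fixed vectors, so its
average is the number of orbits on such tuples, namely `1` (`sum_GL_powFalling`).

For `U` the falling products at `-q` have no such meaning. Instead the moments `E_n[X ^ j]`, `j ≤
n`, are computed by induction on `n` (`sum_moment`) from three facts about the number `u(W)` of
unit vectors in a subspace `W`.
* `mul_numUnit_hermOrth`: `u(W)` and `u(W^⊥)` determine each other, because both are given by the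
  dimension of the subspace and that of the common radical (`mul_numUnit`).
* `sum_numUnit_fixedSpace`: `U` is transitive on unit vectors with stabilizer the unitary group in
  dimension `n - 1`, which evaluates averages weighted by `u(Fix g)`.
* `sum_hermOrth_eq`: let `D` be the group of the `q + 1` reflections along a unit vector `e`. In
  every coset `D g` exactly one element has a fixed space not orthogonal to `e`, and the other `q`
  elements have a fixed space of dimension one less. This evaluates averages weighted by `u((Fix
  g)^⊥)`.
Together they give `E[X ^ (i + 2)] = (1 - x ^ (i + 1)) E[X ^ i]` with `E[1] = 1` and `E[X] = 0`,
which `sum_powFalling_of_moments` translates into falling moments.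

The limits are the sums of the corresponding infinite series, evaluated by Euler's identity for the
product of all `1 + c * t ^ (r + 1)`, with `t = x⁻¹` and `c = -ε` (`eulerSum_eq_mul`,
`tprod_eq_eulerSum`).
-/

/-! ### Falling products in powers of the base -/

/-- The product `(X - 1) (X - x) ⋯ (X - x ^ (l - 1))`. At `X = x ^ d`, with `x` the order of a
finite field, it counts the linearly independent `l`-tuples in a space of dimension `d`. -/
noncomputable def powFalling (x X : ℝ) (l : ℕ) : ℝ := ∏ i ∈ Finset.range l, (X - x ^ i)

lemma powFalling_zero (x X : ℝ) : powFalling x X 0 = 1 := by simp [powFalling]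

lemma powFalling_succ (x X : ℝ) (l : ℕ) :
    powFalling x X (l + 1) = powFalling x X l * (X - x ^ l) := by
  simp [powFalling, Finset.prod_range_succ]

lemma powFalling_succ' (x X : ℝ) (l : ℕ) :
    powFalling x X (l + 1) = (X - 1) * ∏ s ∈ Finset.range l, (X - x ^ (s + 1)) := by
  simp [powFalling, Finset.prod_range_succ', mul_comm]

lemma powFalling_eq_zero (x : ℝ) {d l : ℕ} (h : d < l) : powFalling x (x ^ d) l = 0 :=
  Finset.prod_eq_zero (Finset.mem_range.2 h) (by simp)

lemma powFalling_add (x : ℝ) (k i m : ℕ) :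
    powFalling x (x ^ (k + m)) (k + i) =
      powFalling x (x ^ (k + m)) k * (x ^ (k * i) * powFalling x (x ^ m) i) := by
  simp only [powFalling, Finset.prod_range_add]
  congr 1
  have h : x ^ (k * i) = ∏ _s ∈ Finset.range i, x ^ k := by simp [pow_mul]
  rw [h, ← Finset.prod_mul_distrib]
  refine Finset.prod_congr rfl fun s _ => ?_
  ring

lemma powFalling_self_succ (x : ℝ) (N : ℕ) :
    powFalling x (x ^ (N + 1)) (N + 1) = (x ^ (N + 1) - 1) * (x ^ N * powFalling x (x ^ N) N) := by
  rw [powFalling_succ']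
  congr 1
  have h : x ^ N = ∏ _s ∈ Finset.range N, x := by simp
  rw [powFalling, h, ← Finset.prod_mul_distrib, ← h]
  refine Finset.prod_congr rfl fun s _ => ?_
  ring

lemma powFalling_self_ne_zero {x : ℝ} (hx0 : x ≠ 0) (hx1 : ∀ i : ℕ, x ^ (i + 1) ≠ 1) (N : ℕ) :
    powFalling x (x ^ N) N ≠ 0 := by
  induction N with
  | zero => simp [powFalling_zero]
  | succ N ih =>
    rw [powFalling_self_succ]
    exact mul_ne_zero (sub_ne_zero.2 (hx1 N)) (mul_ne_zero (pow_ne_zero _ hx0) ih)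

/-- Partial sums of the alternating sum of Gaussian binomial coefficients telescope. -/
lemma sum_powFalling_div {x : ℝ} (hx0 : x ≠ 0) (hx1 : ∀ i : ℕ, x ^ (i + 1) ≠ 1) (X : ℝ) (N : ℕ) :
    ∑ i ∈ Finset.range (N + 1),
        (-1) ^ i * x ^ (i.choose 2) * powFalling x X i / powFalling x (x ^ i) i =
      (-1) ^ N * x ^ (N.choose 2) * (∏ s ∈ Finset.range N, (X - x ^ (s + 1))) /
        powFalling x (x ^ N) N := by
  induction N with
  | zero => simp [powFalling_zero]
  | succ N ih =>
    have h1 := powFalling_self_ne_zero hx0 hx1 N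
    have h2 := sub_ne_zero.2 (hx1 N)
    have h3 : (N + 1).choose 2 = N + N.choose 2 := by
      rw [Nat.choose_succ_succ' N 1, Nat.choose_one_right]
    rw [Finset.sum_range_succ, ih, powFalling_self_succ, powFalling_succ', h3,
      Finset.prod_range_succ]
    generalize (∏ s ∈ Finset.range N, (X - x ^ (s + 1))) = R
    have h4 : x ^ N ≠ 0 := pow_ne_zero _ hx0
    field_simp
    ring

/-- The indicator of `d = k` as a combination of the falling products at `x ^ d`. -/
lemma sum_powFalling_eq_ite {x : ℝ} (hx0 : x ≠ 0) (hx1 : ∀ i : ℕ, x ^ (i + 1) ≠ 1)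
    {n d : ℕ} (hd : d ≤ n) (k : ℕ) :
    ∑ i ∈ Finset.range (n + 1 - k), (-1) ^ i * x ^ (i.choose 2) /
        (x ^ (k * i) * powFalling x (x ^ k) k * powFalling x (x ^ i) i) *
          powFalling x (x ^ d) (k + i) = if d = k then 1 else 0 := by
  rcases lt_or_ge d k with h | h
  · rw [if_neg h.ne]
    refine Finset.sum_eq_zero fun i _ => ?_
    rw [powFalling_eq_zero x (show d < k + i by omega), mul_zero]
  obtain ⟨m, rfl⟩ := Nat.exists_eq_add_of_le h
  obtain ⟨N, rfl⟩ : ∃ N, n = k + N := Nat.exists_eq_add_of_le (by omega)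
  have hk := powFalling_self_ne_zero hx0 hx1 k
  have key : ∑ i ∈ Finset.range (N + 1),
      (-1) ^ i * x ^ (i.choose 2) * powFalling x (x ^ m) i / powFalling x (x ^ i) i =
        if m = 0 then 1 else 0 := by
    rcases Nat.eq_zero_or_pos m with rfl | hm
    · rw [Finset.sum_range_succ', Finset.sum_eq_zero]
      · simp [powFalling_zero]
      · intro i _
        rw [powFalling_eq_zero x (by omega)]
        simp
    · rw [sum_powFalling_div hx0 hx1, if_neg hm.ne',
        Finset.prod_eq_zero (i := m - 1) (Finset.mem_range.2 (by omega))]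
      · simp
      · rw [Nat.sub_add_cancel hm, sub_self]
  have hr : k + N + 1 - k = N + 1 := by omega
  have : ∀ i ∈ Finset.range (N + 1), (-1) ^ i * x ^ (i.choose 2) /
        (x ^ (k * i) * powFalling x (x ^ k) k * powFalling x (x ^ i) i) *
          powFalling x (x ^ (k + m)) (k + i) =
      powFalling x (x ^ (k + m)) k / powFalling x (x ^ k) k *
        ((-1) ^ i * x ^ (i.choose 2) * powFalling x (x ^ m) i / powFalling x (x ^ i) i) := by
    intro i _
    have hi := powFalling_self_ne_zero hx0 hx1 i
    have h4 : x ^ (k * i) ≠ 0 := pow_ne_zero _ hx0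
    rw [powFalling_add]
    field_simp
  rw [hr, Finset.sum_congr rfl this, ← Finset.mul_sum, key]
  rcases Nat.eq_zero_or_pos m with rfl | hm
  · simp [hk]
  · rw [if_neg hm.ne', if_neg (by omega), mul_zero]

/-- A statistic `d ≤ n` on a finite set is determined by the averages of the falling products
`powFalling x (x ^ d) l`; here these averages are assumed to be `ε ^ l`. -/
lemma card_eq_of_sum_powFalling {x : ℝ} (hx0 : x ≠ 0) (hx1 : ∀ i : ℕ, x ^ (i + 1) ≠ 1)
    {G : Type*} [Fintype G] [Nonempty G] {n : ℕ} (d : G → ℕ) (hd : ∀ g, d g ≤ n) (ε : ℝ)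
    (h : ∀ l ≤ n, ∑ g, powFalling x (x ^ d g) l = ε ^ l * Nat.card G) (k : ℕ) :
    (Nat.card {g : G // d g = k} : ℝ) / Nat.card G =
      ∑ i ∈ Finset.range (n + 1 - k), (-1) ^ i * x ^ (i.choose 2) /
        (x ^ (k * i) * powFalling x (x ^ k) k * powFalling x (x ^ i) i) * ε ^ (k + i) := by
  have hG : (Nat.card G : ℝ) ≠ 0 := by simp
  have h1 : (Nat.card {g : G // d g = k} : ℝ) = ∑ g, if d g = k then (1 : ℝ) else 0 := by
    rw [Nat.card_eq_fintype_card, Fintype.card_subtype, Finset.sum_boole]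
  rw [h1, Finset.sum_congr rfl fun g _ => (sum_powFalling_eq_ite hx0 hx1 (hd g) k).symm,
    Finset.sum_comm, div_eq_iff hG, Finset.sum_mul]
  refine Finset.sum_congr rfl fun i hi => ?_
  rw [Finset.mem_range] at hi
  rw [← Finset.mul_sum, h (k + i) (by omega), ← mul_assoc]

/-- If `d = n` is attained exactly once then the top falling product gives the cardinality. -/
lemma card_eq_of_sum_powFalling_self {x ε : ℝ} (hε : ε * ε = 1) {G : Type*} [Fintype G] {n : ℕ}
    (d : G → ℕ) (hd : ∀ g, d g ≤ n) (g₀ : G) (hg₀ : ∀ g, d g = n ↔ g = g₀)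
    (h : ∑ g, powFalling x (x ^ d g) n = ε ^ n * Nat.card G) :
    (Nat.card G : ℝ) = ε ^ n * powFalling x (x ^ n) n := by
  rw [Finset.sum_eq_single g₀, (hg₀ g₀).2 rfl] at h
  · rw [h, ← mul_assoc, ← mul_pow, hε, one_pow, one_mul]
  · intro g _ hg
    exact powFalling_eq_zero x (lt_of_le_of_ne (hd g) fun h' => hg ((hg₀ g).1 h'))
  · simp

/-! ### From power moments to falling moments -/

/-- The homogeneous Rogers–Szegő polynomials `∑ i, (-1) ^ i [j choose i]_x t ^ (j - i)`, defined by
the rule that describes multiplication by the variable in the basis of falling products. -/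
noncomputable def szego (x : ℝ) : ℕ → ℝ → ℝ
  | 0, _ => 1
  | j + 1, t => t * szego x j t - szego x j (x * t)

/-- The `x`-difference equation of the Rogers–Szegő polynomials. -/
lemma szego_mul (x : ℝ) (j : ℕ) : ∀ t : ℝ,
    szego x (j + 1) (x * t) = szego x (j + 1) t - t * (1 - x ^ (j + 1)) * szego x j t := by
  induction j with
  | zero => intro t; simp [szego]; ring
  | succ j ih =>
    intro t
    have e1 : szego x (j + 2) (x * t) =
        x * t * szego x (j + 1) (x * t) - szego x (j + 1) (x * (x * t)) := rfl
    have e2 : szego x (j + 2) t = t * szego x (j + 1) t - szego x (j + 1) (x * t) := rfl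
    have e3 : szego x (j + 1) t = t * szego x j t - szego x j (x * t) := rfl
    have e4 := ih (x * t)
    have e5 := ih t
    rw [e1, e2, e4]
    have e6 : szego x j (x * t) = t * szego x j t - szego x (j + 1) t := by rw [e3]; ring
    rw [e6, e5]
    ring

lemma szego_add_two_one (x : ℝ) (j : ℕ) :
    szego x (j + 2) 1 = (1 - x ^ (j + 1)) * szego x j 1 := by
  have e2 : szego x (j + 2) 1 = 1 * szego x (j + 1) 1 - szego x (j + 1) (x * 1) := rfl
  rw [e2, szego_mul]
  ring

/-- If the power moments of `x ^ d` up to order `n` are `szego x j 1`, then its falling moments up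
to order `n` are `(-1) ^ l`. -/
lemma sum_powFalling_of_moments {x : ℝ} {G : Type*} [Fintype G] {n : ℕ} (d : G → ℕ)
    (h : ∀ j ≤ n, ∑ g, (x ^ d g) ^ j = szego x j 1 * Nat.card G) {l : ℕ} (hl : l ≤ n) :
    ∑ g, powFalling x (x ^ d g) l = (-1) ^ l * Nat.card G := by
  suffices H : ∀ l j : ℕ, j + l ≤ n → ∑ g, (x ^ d g) ^ j * powFalling x (x ^ d g) l =
      (-1) ^ l * szego x j (x ^ l) * Nat.card G by
    simpa [szego] using H l 0 (by omega)
  intro l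
  induction l with
  | zero => intro j hj; simpa [powFalling_zero] using h j hj
  | succ l ih =>
    intro j hj
    have e : ∀ g, (x ^ d g) ^ j * powFalling x (x ^ d g) (l + 1) =
        (x ^ d g) ^ (j + 1) * powFalling x (x ^ d g) l -
          x ^ l * ((x ^ d g) ^ j * powFalling x (x ^ d g) l) := by
      intro g; rw [powFalling_succ]; ring
    rw [Finset.sum_congr rfl fun g _ => e g, Finset.sum_sub_distrib, ← Finset.mul_sum,
      ih (j + 1) (by omega), ih j (by omega)]
    have e2 : szego x (j + 1) (x ^ l) = x ^ l * szego x j (x ^ l) - szego x j (x * x ^ l) := rfl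
    rw [e2, pow_succ' x l]
    ring

/-! ### Euler's product and the limiting distribution -/

/-- The coefficient `∏ j = 1, …, i, t ^ j / (1 - t ^ j)` of Euler's expansion of an infinite
product. -/
noncomputable def eulerCoeff (t : ℝ) (i : ℕ) : ℝ :=
  ∏ j ∈ Finset.range i, t ^ (j + 1) / (1 - t ^ (j + 1))

lemma eulerCoeff_succ (t : ℝ) (i : ℕ) :
    eulerCoeff t (i + 1) = eulerCoeff t i * (t ^ (i + 1) / (1 - t ^ (i + 1))) :=
  Finset.prod_range_succ _ _

lemma one_sub_pow_ne_zero {t : ℝ} (ht : |t| < 1) (i : ℕ) : 1 - t ^ (i + 1) ≠ 0 := by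
  intro h
  have h1 : |t ^ (i + 1)| < 1 := by
    rw [abs_pow]
    exact pow_lt_one₀ (abs_nonneg t) ht (Nat.succ_ne_zero i)
  rw [← sub_eq_zero.1 h] at h1
  simp at h1

lemma tendsto_pow_succ_zero {t : ℝ} (ht : |t| < 1) :
    Tendsto (fun i : ℕ => t ^ (i + 1)) atTop (𝓝 0) :=
  (tendsto_pow_atTop_nhds_zero_of_abs_lt_one ht).comp (tendsto_add_atTop_nat 1)

lemma summable_eulerCoeff {t : ℝ} (ht0 : t ≠ 0) (ht : |t| < 1) :
    Summable (fun i => |eulerCoeff t i|) := by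
  have hne : ∀ i, eulerCoeff t i ≠ 0 := fun i =>
    Finset.prod_ne_zero_iff.2 fun j _ => div_ne_zero (pow_ne_zero _ ht0) (one_sub_pow_ne_zero ht j)
  refine summable_of_ratio_test_tendsto_lt_one (l := 0) zero_lt_one
    (Eventually.of_forall fun i => abs_ne_zero.2 (hne i)) ?_
  have h1 : ∀ i, ‖|eulerCoeff t (i + 1)|‖ / ‖|eulerCoeff t i|‖ =
      |t ^ (i + 1) / (1 - t ^ (i + 1))| := by
    intro i
    rw [Real.norm_eq_abs, Real.norm_eq_abs, abs_abs, abs_abs, ← abs_div, eulerCoeff_succ,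
      mul_div_cancel_left₀ _ (hne i)]
  simp_rw [h1]
  have h2 := (tendsto_pow_succ_zero ht).div ((tendsto_const_nhds (x := (1 : ℝ))).sub
    (tendsto_pow_succ_zero ht)) (by norm_num)
  simpa using h2.abs

/-- The sum of Euler's series for the product of all `1 + c * t ^ (k + r + 1)`. -/
noncomputable def eulerSum (c t : ℝ) (k : ℕ) : ℝ := ∑' i, c ^ i * t ^ (k * i) * eulerCoeff t i

lemma abs_eulerTerm_le {c t : ℝ} (hc : |c| = 1) (ht : |t| < 1) (k i : ℕ) :
    ‖c ^ i * t ^ (k * i) * eulerCoeff t i‖ ≤ |eulerCoeff t i| := by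
  rw [norm_mul, norm_mul, norm_pow, norm_pow, Real.norm_eq_abs, Real.norm_eq_abs, Real.norm_eq_abs,
    hc, one_pow, one_mul]
  exact mul_le_of_le_one_left (abs_nonneg _) (pow_le_one₀ (abs_nonneg _) ht.le)

lemma summable_eulerTerm {c t : ℝ} (hc : |c| = 1) (ht0 : t ≠ 0) (ht : |t| < 1) (k : ℕ) :
    Summable (fun i => c ^ i * t ^ (k * i) * eulerCoeff t i) :=
  (summable_eulerCoeff ht0 ht).of_norm_bounded (abs_eulerTerm_le hc ht k)

lemma eulerSum_eq_mul {c t : ℝ} (hc : |c| = 1) (ht0 : t ≠ 0) (ht : |t| < 1) (k : ℕ) :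
    eulerSum c t k = (1 + c * t ^ (k + 1)) * eulerSum c t (k + 1) := by
  have s0 := summable_eulerTerm hc ht0 ht k
  have s1 := summable_eulerTerm hc ht0 ht (k + 1)
  have h : eulerSum c t k - eulerSum c t (k + 1) = c * t ^ (k + 1) * eulerSum c t (k + 1) := by
    unfold eulerSum
    rw [← s0.tsum_sub s1, (s0.sub s1).tsum_eq_zero_add, ← tsum_mul_left]
    simp only [pow_zero, mul_zero, sub_self, zero_add]
    refine tsum_congr fun i => ?_
    have := one_sub_pow_ne_zero ht i
    rw [eulerCoeff_succ]
    field_simp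
    ring
  linarith

lemma tendsto_eulerSum {c t : ℝ} (hc : |c| = 1) (ht0 : t ≠ 0) (ht : |t| < 1) :
    Tendsto (eulerSum c t) atTop (𝓝 1) := by
  have h1 : (∑' i : ℕ, if i = 0 then (1 : ℝ) else 0) = 1 := by simp
  rw [← h1]
  refine tendsto_tsum_of_dominated_convergence (summable_eulerCoeff ht0 ht) (fun i => ?_)
    (Eventually.of_forall fun k i => abs_eulerTerm_le hc ht k i)
  rcases Nat.eq_zero_or_pos i with rfl | hi
  · simp [eulerCoeff]
  · rw [if_neg hi.ne']
    have h2 : Tendsto (fun k : ℕ => t ^ (k * i)) atTop (𝓝 0) :=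
      (tendsto_pow_atTop_nhds_zero_of_abs_lt_one ht).comp
        (tendsto_id.atTop_mul_const' hi)
    simpa using (h2.const_mul (c ^ i)).mul_const (eulerCoeff t i)

lemma eulerSum_eq_prod_mul {c t : ℝ} (hc : |c| = 1) (ht0 : t ≠ 0) (ht : |t| < 1) (k : ℕ) :
    eulerSum c t 0 = (∏ r ∈ Finset.range k, (1 + c * t ^ (r + 1))) * eulerSum c t k := by
  induction k with
  | zero => simp
  | succ k ih => rw [ih, eulerSum_eq_mul hc ht0 ht k, Finset.prod_range_succ, mul_assoc]

lemma multipliable_one_add_mul_pow {c t : ℝ} (ht : |t| < 1) :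
    Multipliable (fun r : ℕ => 1 + c * t ^ (r + 1)) := by
  refine multipliable_one_add_of_summable ?_
  have := (summable_geometric_of_lt_one (abs_nonneg t) ht).mul_left (|c| * |t|)
  refine this.congr fun r => ?_
  rw [norm_mul, norm_pow, Real.norm_eq_abs, Real.norm_eq_abs]
  ring

lemma tprod_eq_eulerSum {c t : ℝ} (hc : |c| = 1) (ht0 : t ≠ 0) (ht : |t| < 1) :
    ∏' r : ℕ, (1 + c * t ^ (r + 1)) = eulerSum c t 0 := by
  have h1 := (multipliable_one_add_mul_pow (c := c) ht).hasProd.tendsto_prod_nat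
  have h2 := h1.mul (tendsto_eulerSum hc ht0 ht)
  simp_rw [← eulerSum_eq_prod_mul hc ht0 ht, mul_one] at h2
  exact tendsto_nhds_unique h2 tendsto_const_nhds

lemma powFalling_self_eq_prod {x : ℝ} (hx0 : x ≠ 0) (k : ℕ) :
    powFalling x (x ^ k) k = x ^ (k ^ 2) * ∏ r ∈ Finset.range k, (1 - x⁻¹ ^ (r + 1)) := by
  induction k with
  | zero => simp [powFalling_zero]
  | succ k ih =>
    rw [powFalling_self_succ, ih, Finset.prod_range_succ, inv_pow]
    have : x ^ (k + 1) ≠ 0 := pow_ne_zero _ hx0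
    field_simp
    ring

lemma eulerCoeff_inv {x : ℝ} (hx0 : x ≠ 0) (hx1 : ∀ i : ℕ, x ^ (i + 1) ≠ 1) (i : ℕ) :
    eulerCoeff x⁻¹ i = x ^ (i.choose 2) / powFalling x (x ^ i) i := by
  induction i with
  | zero => simp [eulerCoeff, powFalling_zero]
  | succ i ih =>
    have h1 := powFalling_self_ne_zero hx0 hx1 i
    have h2 := sub_ne_zero.2 (hx1 i)
    have h3 : (i + 1).choose 2 = i + i.choose 2 := by
      rw [Nat.choose_succ_succ' i 1, Nat.choose_one_right]
    have h4 : x ^ i ≠ 0 := pow_ne_zero _ hx0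
    have h5 : x ^ (i + 1) ≠ 0 := pow_ne_zero _ hx0
    have h6 : x⁻¹ ^ (i + 1) / (1 - x⁻¹ ^ (i + 1)) = 1 / (x ^ (i + 1) - 1) := by
      rw [inv_pow]
      have : 1 - (x ^ (i + 1))⁻¹ ≠ 0 := by
        rw [sub_ne_zero]
        intro h
        exact hx1 i (by rw [← inv_inv (x ^ (i + 1)), ← h, inv_one])
      field_simp
    rw [eulerCoeff_succ, ih, h6, powFalling_self_succ, h3]
    field_simp
    ring

/-- The limit `n → ∞` of the finite formula, with `N k` the order of the group of rank `k`. -/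
lemma tendsto_finite_formula {x ε : ℝ} (hx : 1 < |x|) (hε : ε * ε = 1) (N : ℕ → ℕ)
    (hN : ∀ k, (N k : ℝ) = ε ^ k * powFalling x (x ^ k) k) (k : ℕ) :
    Tendsto (fun n : ℕ => 1 / (N k : ℝ) * ∑ i ∈ Finset.range (n + 1 - k),
        (-1 : ℝ) ^ i * x ^ (i.choose 2) / (x ^ (k * i) * (N i : ℝ))) atTop
      (𝓝 ((∏' r : ℕ, (1 + -ε * x⁻¹ ^ (r + 1))) *
        (1 / (ε ^ k * x ^ (k ^ 2) * ((∏ r ∈ Finset.range k, (1 - x⁻¹ ^ (r + 1))) *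
          ∏ r ∈ Finset.range k, (1 + -ε * x⁻¹ ^ (r + 1))))))) := by
  have hx0 : x ≠ 0 := by rintro rfl; simp at hx; linarith
  have ht : |x⁻¹| < 1 := by rw [abs_inv]; exact inv_lt_one_of_one_lt₀ hx
  have ht0 : x⁻¹ ≠ 0 := inv_ne_zero hx0
  have hx1 : ∀ i : ℕ, x ^ (i + 1) ≠ 1 := by
    intro i h
    have := one_lt_pow₀ hx (Nat.succ_ne_zero i)
    rw [← abs_pow, Nat.succ_eq_add_one, h] at this
    simp at this
  have hc : |(-ε)| = 1 := by
    rw [abs_neg, ← sq_eq_sq₀ (abs_nonneg _) zero_le_one, sq_abs, one_pow, sq, hε]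
  have hε0 : ε ≠ 0 := by rintro rfl; simp at hε
  have hterm : ∀ i, (-1 : ℝ) ^ i * x ^ (i.choose 2) / (x ^ (k * i) * (N i : ℝ)) =
      (-ε) ^ i * x⁻¹ ^ (k * i) * eulerCoeff x⁻¹ i := by
    intro i
    have h1 := powFalling_self_ne_zero hx0 hx1 i
    have h4 : x ^ (k * i) ≠ 0 := pow_ne_zero _ hx0
    have h5 : ε ^ i * ε ^ i = 1 := by rw [← mul_pow, hε, one_pow]
    have h6 : ε ^ i ≠ 0 := pow_ne_zero _ hε0
    have h7 : (-ε) ^ i = (-1) ^ i * ε ^ i := by rw [← mul_pow, neg_one_mul]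
    rw [hN, eulerCoeff_inv hx0 hx1, inv_pow, h7]
    rw [← one_mul ((-1 : ℝ) ^ i * x ^ i.choose 2), ← h5]
    field_simp
  have hne : ∀ r : ℕ, 1 + -ε * x⁻¹ ^ (r + 1) ≠ 0 := by
    intro r h
    have h1 : |x⁻¹ ^ (r + 1)| < 1 := by
      rw [abs_pow]; exact pow_lt_one₀ (abs_nonneg _) ht (Nat.succ_ne_zero r)
    have h2 : -ε * x⁻¹ ^ (r + 1) = -1 := by linarith
    have h3 := congrArg abs h2
    rw [abs_mul, hc, one_mul, abs_neg, abs_one] at h3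
    linarith
  have hprod : ∏ r ∈ Finset.range k, (1 + -ε * x⁻¹ ^ (r + 1)) ≠ 0 :=
    Finset.prod_ne_zero_iff.2 fun r _ => hne r
  have hlim : (∏' r : ℕ, (1 + -ε * x⁻¹ ^ (r + 1))) *
        (1 / (ε ^ k * x ^ (k ^ 2) * ((∏ r ∈ Finset.range k, (1 - x⁻¹ ^ (r + 1))) *
          ∏ r ∈ Finset.range k, (1 + -ε * x⁻¹ ^ (r + 1))))) =
      1 / (N k : ℝ) * eulerSum (-ε) x⁻¹ k := by
    rw [tprod_eq_eulerSum hc ht0 ht, eulerSum_eq_prod_mul hc ht0 ht k, hN,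
      powFalling_self_eq_prod hx0]
    generalize (∏ r ∈ Finset.range k, (1 + -ε * x⁻¹ ^ (r + 1))) = R at hprod
    field_simp
  rw [hlim]
  refine Tendsto.const_mul _ ?_
  simp_rw [hterm]
  have htop : Tendsto (fun n : ℕ => n + 1 - k) atTop atTop :=
    (tendsto_sub_atTop_nat k).comp (tendsto_add_atTop_nat 1)
  exact (summable_eulerTerm hc ht0 ht k).hasSum.tendsto_sum_nat.comp htop

/-! ### Matrices as linear maps, and counting fixed points of transitive actions -/

section General

variable {F : Type*} [Field F] {n : ℕ}

/-- The action of a matrix group on column vectors. -/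
abbrev colMap (g : GL (Fin n) F) : (Fin n → F) →ₗ[F] (Fin n → F) :=
  Matrix.mulVecLin (g : Matrix (Fin n) (Fin n) F)

/-- The fixed space of an invertible matrix. -/
abbrev fixedSpace (g : GL (Fin n) F) : Submodule F (Fin n → F) := (colMap g).fixedSubmodule

lemma mem_fixedSpace {g : GL (Fin n) F} {x : Fin n → F} : x ∈ fixedSpace g ↔ colMap g x = x :=
  LinearMap.mem_fixedSubmodule_iff

lemma fixedDim_eq (g : GL (Fin n) F) : fixedDim g = Module.finrank F (fixedSpace g) := rfl

lemma fixedDim_le (g : GL (Fin n) F) : fixedDim g ≤ n  :=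
  (Submodule.finrank_le (fixedSpace g)).trans_eq (by simp)

@[simp] lemma colMap_one (x : Fin n → F) : colMap (1 : GL (Fin n) F) x = x := by simp

@[simp] lemma colMap_mul (g h : GL (Fin n) F) (x : Fin n → F) :
    colMap (g * h) x = colMap g (colMap h x) := by simp [Matrix.mulVec_mulVec]

lemma colMap_injective : Function.Injective (colMap : GL (Fin n) F → _) := by
  intro g h hgh
  exact Units.ext (Matrix.mulVec_injective (funext fun x => LinearMap.congr_fun hgh x))

lemma exists_colMap_eq (T : (Fin n → F) →ₗ[F] (Fin n → F)) (hT : Function.Injective T) :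
    ∃ g : GL (Fin n) F, colMap g = T := by
  have hu : IsUnit (LinearMap.toMatrix' T) := by
    rw [Matrix.isUnit_iff_isUnit_det, LinearMap.det_toMatrix', isUnit_iff_ne_zero]
    intro h0
    obtain ⟨m, hm, hm0⟩ := LinearMap.bot_lt_ker_of_det_eq_zero h0 |>.ne' |>
      (Submodule.ne_bot_iff _).1
    exact hm0 (hT (by simpa using hm))
  obtain ⟨g, hg⟩ := hu
  refine ⟨g, ?_⟩
  refine LinearMap.ext fun x => ?_
  rw [colMap, hg, Matrix.mulVecLin_apply, LinearMap.toMatrix'_mulVec]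

lemma fixedDim_eq_top_iff (g : GL (Fin n) F) : fixedDim g = n ↔ g = 1 := by
  have h : fixedDim g = n ↔ fixedSpace g = ⊤ := by
    constructor
    · intro h
      exact Submodule.eq_top_of_finrank_eq (by simpa [fixedDim_eq] using h)
    · intro h
      rw [fixedDim_eq, h]
      simp
  rw [h, Submodule.eq_top_iff']
  constructor
  · intro h
    refine colMap_injective (LinearMap.ext fun x => ?_)
    rw [mem_fixedSpace.1 (h x), colMap_one]
  · rintro rfl x
    exact mem_fixedSpace.2 (colMap_one x)

lemma fixedDim_conj (g h : GL (Fin n) F) : fixedDim (h * g * h⁻¹) = fixedDim g := by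
  have hmem : ∀ x, x ∈ fixedSpace g ↔ colMap h x ∈ fixedSpace (h * g * h⁻¹) := by
    intro x
    have hinv : ∀ y, colMap h⁻¹ (colMap h y) = y := fun y => by
      rw [← colMap_mul, inv_mul_cancel, colMap_one]
    rw [mem_fixedSpace, mem_fixedSpace, colMap_mul, colMap_mul, hinv]
    constructor
    · intro hx; rw [hx]
    · intro hx
      rw [← hinv (colMap g x), hx, hinv]
  have hinj : Function.Injective (colMap h) := by
    intro x y hxy
    have := congrArg (colMap h⁻¹) hxy
    rwa [← colMap_mul, ← colMap_mul, inv_mul_cancel, colMap_one, colMap_one] at this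
  have hmap : (fixedSpace g).map (colMap h) = fixedSpace (h * g * h⁻¹) := by
    ext y
    constructor
    · rintro ⟨x, hx, rfl⟩
      exact (hmem x).1 hx
    · intro hy
      have hinv' : colMap h (colMap h⁻¹ y) = y := by
        rw [← colMap_mul, mul_inv_cancel, colMap_one]
      exact ⟨colMap h⁻¹ y, (hmem _).2 (by rwa [hinv']), hinv'⟩
  rw [fixedDim_eq, fixedDim_eq, ← hmap]
  exact (LinearEquiv.finrank_eq (Submodule.equivMapOfInjective _ hinj _)).symm

end General

/-- Double counting of the pairs `(g, a)` with `g • a = a`, weighted by a class function of `g`, for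
a transitive action. -/
lemma sum_mul_card_fixed {G α : Type*} [Group G] [Fintype G] [Fintype α] [MulAction G α]
    [MulAction.IsPretransitive G α] (φ : G → ℝ) (hφ : ∀ g h, φ (h * g * h⁻¹) = φ g) (a₀ : α)
    [Fintype (MulAction.stabilizer G a₀)] :
    ∑ g, φ g * (Nat.card {a : α // g • a = a} : ℝ) =
      Nat.card α * ∑ g : MulAction.stabilizer G a₀, φ g := by
  classical
  have h1 : ∀ g : G, (Nat.card {a : α // g • a = a} : ℝ) = ∑ a : α, if g • a = a then 1 else 0 := by
    intro g
    rw [Nat.card_eq_fintype_card, Fintype.card_subtype, Finset.sum_boole]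
  have h2 : ∀ a : α, ∑ g : G, φ g * (if g • a = a then (1 : ℝ) else 0) =
      ∑ g : MulAction.stabilizer G a₀, φ g := by
    intro a
    obtain ⟨h, rfl⟩ := MulAction.exists_smul_eq G a₀ a
    have e : ∑ g : MulAction.stabilizer G a₀, φ g =
        ∑ g : G, φ g * (if g • a₀ = a₀ then (1 : ℝ) else 0) := by
      simp only [mul_ite, mul_one, mul_zero]
      rw [← Finset.sum_filter]
      exact (Finset.sum_subtype _ (by simp [MulAction.mem_stabilizer_iff]) _).symm
    rw [e, ← (MulAut.conj h).toEquiv.sum_comp]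
    refine Finset.sum_congr rfl fun g _ => ?_
    have e1 : (MulAut.conj h).toEquiv g = h * g * h⁻¹ := rfl
    have e2 : (h * g * h⁻¹) • h • a₀ = h • a₀ ↔ g • a₀ = a₀ := by
      rw [smul_smul, inv_mul_cancel_right, mul_smul, smul_left_cancel_iff]
    rw [e1, hφ]
    simp only [e2]
  rw [Finset.sum_congr rfl fun g _ => by rw [h1, Finset.mul_sum], Finset.sum_comm,
    Finset.sum_congr rfl fun a _ => h2 a, Finset.sum_const, Finset.card_univ, nsmul_eq_mul,
    Nat.card_eq_fintype_card]

lemma card_eq_card_mul_card_stabilizer {G α : Type*} [Group G] [MulAction G α]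
    [MulAction.IsPretransitive G α] (a₀ : α) :
    Nat.card G = Nat.card α * Nat.card (MulAction.stabilizer G a₀) := by
  rw [← Subgroup.index_mul_card (MulAction.stabilizer G a₀),
    MulAction.index_stabilizer_of_transitive]

/-! ### The general linear group -/

section GeneralLinear

variable {F : Type*} [Field F] {n : ℕ}

/-- The action of the general linear group on linearly independent tuples of column vectors. -/
abbrev tupleAction (n j : ℕ) (F : Type*) [Field F] :
    MulAction (GL (Fin n) F) {s : Fin j → Fin n → F // LinearIndependent F s} where
  smul g s := ⟨fun i => colMap g (s.1 i), s.2.map' (colMap g) (LinearMap.ker_eq_bot.2 fun x y h =>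
    by
    have := congrArg (colMap g⁻¹) h
    rwa [← colMap_mul, ← colMap_mul, inv_mul_cancel, colMap_one, colMap_one] at this)⟩
  one_smul s := Subtype.ext (funext fun i => colMap_one _)
  mul_smul g h s := Subtype.ext (funext fun i => colMap_mul g h _)

lemma tupleAction_isPretransitive (n j : ℕ) (F : Type*) [Field F] :
    letI := tupleAction n j F
    MulAction.IsPretransitive (GL (Fin n) F)
      {s : Fin j → Fin n → F // LinearIndependent F s} := by
  let := tupleAction n j F
  refine ⟨fun s t => ?_⟩
  have bs := Module.Basis.sumExtend s.2
  have bt := Module.Basis.sumExtend t.2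
  have : Finite (Fin j ⊕ Module.Basis.sumExtendIndex s.2) := Module.Finite.finite_basis bs
  have : Finite (Fin j ⊕ Module.Basis.sumExtendIndex t.2) := Module.Finite.finite_basis bt
  have : Finite (Module.Basis.sumExtendIndex s.2) := Finite.sum_right (Fin j)
  have : Finite (Module.Basis.sumExtendIndex t.2) := Finite.sum_right (Fin j)
  have hcard : Nat.card (Module.Basis.sumExtendIndex s.2) =
      Nat.card (Module.Basis.sumExtendIndex t.2) := by
    have h1 := Module.finrank_eq_nat_card_basis bs
    have h2 := Module.finrank_eq_nat_card_basis bt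
    rw [Nat.card_sum] at h1 h2
    omega
  obtain ⟨e⟩ := Finite.card_eq.1 hcard
  let T := (Module.Basis.sumExtend s.2).equiv (Module.Basis.sumExtend t.2)
    (Equiv.sumCongr (Equiv.refl _) e)
  obtain ⟨g, hg⟩ := exists_colMap_eq T.toLinearMap T.injective
  refine ⟨g, Subtype.ext (funext fun i => ?_)⟩
  have h1 : Module.Basis.sumExtend s.2 (Sum.inl i) = s.1 i := by
    simp [Module.Basis.sumExtend]
    rfl
  have h2 : Module.Basis.sumExtend t.2 (Sum.inl i) = t.1 i := by
    simp [Module.Basis.sumExtend]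
    rfl
  change colMap g (s.1 i) = t.1 i
  rw [hg, ← h1, ← h2]
  simp [T]

/-- `powFalling` counts linearly independent tuples, also when there are none. -/
lemma card_linearIndependent_eq_powFalling [Finite F] {V : Type*} [AddCommGroup V] [Module F V]
    [Finite V] (j : ℕ) :
    (Nat.card {s : Fin j → V // LinearIndependent F s} : ℝ) =
      powFalling (Nat.card F) ((Nat.card F : ℝ) ^ Module.finrank F V) j := by
  have := Fintype.ofFinite F
  rcases le_or_gt j (Module.finrank F V) with h | h
  · rw [card_linearIndependent h, Nat.card_eq_fintype_card, powFalling,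
      ← Fin.prod_univ_eq_prod_range (fun i => ((Fintype.card F : ℝ) ^ Module.finrank F V -
        (Fintype.card F : ℝ) ^ i)), Nat.cast_prod]
    refine Finset.prod_congr rfl fun i _ => ?_
    rw [Nat.cast_sub (Nat.pow_le_pow_right Fintype.card_pos (by omega))]
    simp
  · rw [powFalling_eq_zero _ h]
    have : IsEmpty {s : Fin j → V // LinearIndependent F s} := by
      refine ⟨fun s => ?_⟩
      have := s.2.fintype_card_le_finrank
      simp at this
      omega
    simp

lemma card_GL_eq_powFalling [Finite F] (k : ℕ) :
    (Nat.card (GL (Fin k) F) : ℝ) = powFalling (Nat.card F) ((Nat.card F : ℝ) ^ k) k := by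
  have := Fintype.ofFinite F
  have h := card_linearIndependent_eq_powFalling (F := F) (V := Fin k → F) k
  rw [Module.finrank_fin_fun] at h
  rw [← h, Nat.card_congr (Matrix.equiv_GL_linearindependent k)]

/-- Burnside's lemma for linearly independent tuples: on average, an element of `GL` fixes exactly
one. -/
lemma sum_GL_powFalling [Finite F] [Fintype (GL (Fin n) F)] {l : ℕ} (hl : l ≤ n) :
    ∑ g : GL (Fin n) F, powFalling (Nat.card F) ((Nat.card F : ℝ) ^ fixedDim g) l =
      Nat.card (GL (Fin n) F) := by
  let := tupleAction n l F
  have := tupleAction_isPretransitive n l F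
  have := Fintype.ofFinite {s : Fin l → Fin n → F // LinearIndependent F s}
  have hfix : ∀ g : GL (Fin n) F, powFalling (Nat.card F) ((Nat.card F : ℝ) ^ fixedDim g) l =
      1 * (Nat.card {s : {s : Fin l → Fin n → F // LinearIndependent F s} // g • s = s} : ℝ) := by
    intro g
    rw [fixedDim_eq, ← card_linearIndependent_eq_powFalling, one_mul, Nat.cast_inj]
    refine Nat.card_congr ⟨fun s => ⟨⟨fun i => s.1 i, s.2.map' (Submodule.subtype _)
      (Submodule.ker_subtype _)⟩, Subtype.ext (funext fun i => mem_fixedSpace.1 (s.1 i).2)⟩,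
      fun s => ⟨fun i => ⟨s.1.1 i, mem_fixedSpace.2 (congrFun (congrArg Subtype.val s.2) i)⟩,
        LinearIndependent.of_comp (Submodule.subtype _) s.1.2⟩, fun s => rfl, fun s => rfl⟩
  let s₀ : {s : Fin l → Fin n → F // LinearIndependent F s} :=
    ⟨fun i => Pi.basisFun F (Fin n) (Fin.castLE hl i),
      (Pi.basisFun F (Fin n)).linearIndependent.comp _ (Fin.castLE_injective hl)⟩
  have := Fintype.ofFinite (MulAction.stabilizer (GL (Fin n) F) s₀)
  rw [Finset.sum_congr rfl fun g _ => hfix g,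
    sum_mul_card_fixed (fun _ => (1 : ℝ)) (fun _ _ => rfl) s₀, Finset.sum_const, Finset.card_univ,
    nsmul_eq_mul, mul_one, ← Nat.card_eq_fintype_card, ← Nat.cast_mul,
    ← card_eq_card_mul_card_stabilizer]

lemma fixedProb_GL [Finite F] (n k : ℕ) :
    fixedProb (⊤ : Subgroup (GL (Fin n) F)) k =
      1 / (Nat.card (GL (Fin k) F) : ℝ) *
        ∑ i ∈ Finset.range (n + 1 - k),
          (-1 : ℝ) ^ i * (Nat.card F : ℝ) ^ (i.choose 2) /
            ((Nat.card F : ℝ) ^ (k * i) * (Nat.card (GL (Fin i) F) : ℝ)) := by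
  have := Fintype.ofFinite (GL (Fin n) F)
  have hq : 1 < (Nat.card F : ℝ) := by exact_mod_cast Finite.one_lt_card
  have h := card_eq_of_sum_powFalling (x := Nat.card F) (by positivity)
    (fun i => (one_lt_pow₀ hq (Nat.succ_ne_zero i)).ne') (fun g : GL (Fin n) F => fixedDim g)
    fixedDim_le 1 (fun l hl => by rw [sum_GL_powFalling hl]; simp) k
  have e1 : Nat.card {g : (⊤ : Subgroup (GL (Fin n) F)) // fixedDim (g : GL (Fin n) F) = k} =
      Nat.card {g : GL (Fin n) F // fixedDim g = k} :=
    Nat.card_congr (Subgroup.topEquiv.toEquiv.subtypeEquiv fun g => Iff.rfl)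
  rw [fixedProb, e1, Subgroup.card_top, h, Finset.mul_sum]
  refine Finset.sum_congr rfl fun i _ => ?_
  rw [card_GL_eq_powFalling, card_GL_eq_powFalling]
  simp only [one_pow, mul_one]
  rw [div_mul_div_comm, one_mul]
  ring_nf

end GeneralLinear

/-! ### Fields of square order and their involution -/

/-- `K` is a finite field with `q ^ 2` elements and `a ↦ a ^ q` is additive, so that this map is the
nontrivial involution of `K`. -/
structure IsQuadraticField (q : ℕ) (K : Type*) [Field K] : Prop where
  finite : Finite K
  card : Nat.card K = q ^ 2
  one_lt : 1 < q
  add_pow : ∀ a b : K, (a + b) ^ q = a ^ q + b ^ q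

lemma isQuadraticField_of_card {q : ℕ} {F K : Type*} [Field F] [Finite F] (hF : Nat.card F = q)
    [Field K] [Finite K] (hK : Nat.card K = q ^ 2) : IsQuadraticField q K := by
  refine ⟨inferInstance, hK, hF ▸ Finite.one_lt_card, ?_⟩
  have := Fintype.ofFinite F
  have := Fintype.ofFinite K
  obtain ⟨p, _⟩ := CharP.exists F
  obtain ⟨p', _⟩ := CharP.exists K
  obtain ⟨m, hp, hm⟩ := FiniteField.card F p
  obtain ⟨m', hp', hm'⟩ := FiniteField.card K p'
  rw [Nat.card_eq_fintype_card] at hF hK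
  have h1 : p ∣ p' ^ (m' : ℕ) := by
    rw [← hm', hK, ← hF, hm, ← pow_mul]
    exact dvd_pow_self p (by have := m.pos; omega)
  have h2 : p = p' := (Nat.prime_dvd_prime_iff_eq hp hp').1 (hp.dvd_of_dvd_pow h1)
  subst h2
  have : Fact p.Prime := ⟨hp⟩
  intro a b
  rw [← hF, hm]
  exact add_pow_char_pow a b p m

namespace IsQuadraticField

variable {q : ℕ} {K : Type*} [Field K] (h : IsQuadraticField q K)
include h

lemma q_ne_zero : q ≠ 0 := by have := h.one_lt; omega

lemma pow_pow (a : K) : (a ^ q) ^ q = a := by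
  have := h.finite
  have := Fintype.ofFinite K
  rw [← pow_mul, ← sq, ← h.card, Nat.card_eq_fintype_card, FiniteField.pow_card]

lemma sub_pow (a b : K) : (a - b) ^ q = a ^ q - b ^ q := by
  have := h.add_pow (a - b) b
  rw [sub_add_cancel] at this
  rw [this, add_sub_cancel_right]

lemma neg_pow (a : K) : (-a) ^ q = -a ^ q := by
  have := h.sub_pow 0 a
  rwa [zero_sub, zero_pow h.q_ne_zero, zero_sub] at this

lemma sum_pow {ι : Type*} (s : Finset ι) (f : ι → K) : (∑ i ∈ s, f i) ^ q = ∑ i ∈ s, f i ^ q := by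
  let φ : K →+ K := ⟨⟨fun a => a ^ q, zero_pow h.q_ne_zero⟩, h.add_pow⟩
  exact map_sum φ f s

lemma card_units : Nat.card Kˣ = (q + 1) * (q - 1) := by
  classical
  have := h.finite
  have := Fintype.ofFinite K
  have h1 := h.card
  rw [Nat.card_eq_fintype_card] at h1
  rw [Nat.card_eq_fintype_card, Fintype.card_units, h1]
  simpa using Nat.sq_sub_sq q 1

lemma card_norm_eq_one : Nat.card {a : K // a ^ (q + 1) = 1} = q + 1 := by
  have := h.finite
  have h1 := IsCyclic.card_powMonoidHom_ker Kˣ (q + 1)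
  rw [h.card_units, Nat.gcd_eq_right (Dvd.intro _ rfl)] at h1
  refine Eq.trans (Nat.card_congr ⟨fun a => ⟨Units.ofPowEqOne a.1 (q + 1) a.2 (by omega),
    MonoidHom.mem_ker.2 (Units.pow_ofPowEqOne _ _)⟩, fun a => ⟨a.1, ?_⟩, fun a => rfl,
    fun a => Subtype.ext (Units.ext rfl)⟩) h1
  have := a.2
  rw [MonoidHom.mem_ker, powMonoidHom_apply] at this
  rw [← Units.val_pow_eq_pow_val, this, Units.val_one]

/-- The norm `a ↦ a ^ (q + 1)` maps onto the fixed field of the involution. -/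
lemma exists_norm_eq {c : K} (hc0 : c ≠ 0) (hc : c ^ q = c) : ∃ a : K, a ^ (q + 1) = c := by
  have := h.finite
  have hq := h.one_lt
  have h1 := IsCyclic.card_powMonoidHom_range Kˣ (q + 1)
  have h2 := IsCyclic.card_powMonoidHom_ker Kˣ (q - 1)
  rw [h.card_units, Nat.gcd_eq_right (Dvd.intro _ rfl), Nat.mul_div_cancel_left _ (by omega)] at h1
  rw [h.card_units, Nat.gcd_eq_right (Dvd.intro_left _ rfl)] at h2
  have hle : (powMonoidHom (q + 1) : Kˣ →* Kˣ).range ≤ (powMonoidHom (q - 1) : Kˣ →* Kˣ).ker := by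
    rintro _ ⟨a, rfl⟩
    rw [MonoidHom.mem_ker, powMonoidHom_apply, powMonoidHom_apply, ← pow_mul, ← h.card_units,
      pow_card_eq_one']
  have heq := Subgroup.eq_of_le_of_card_ge hle (by rw [h1, h2])
  have hmem : Units.mk0 c hc0 ∈ (powMonoidHom (q - 1) : Kˣ →* Kˣ).ker := by
    rw [MonoidHom.mem_ker, powMonoidHom_apply]
    refine Units.ext ?_
    rw [Units.val_pow_eq_pow_val, Units.val_mk0, Units.val_one]
    refine mul_right_cancel₀ hc0 ?_
    rw [← pow_succ, Nat.sub_add_cancel hq.le, hc, one_mul]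
  rw [← heq] at hmem
  obtain ⟨a, ha⟩ := hmem
  refine ⟨a, ?_⟩
  have := congrArg Units.val ha
  simpa using this

lemma card_norm_eq {c : K} (hc0 : c ≠ 0) (hc : c ^ q = c) :
    Nat.card {a : K // a ^ (q + 1) = c} = q + 1 := by
  obtain ⟨b, hb⟩ := h.exists_norm_eq hc0 hc
  have hb0 : b ≠ 0 := by rintro rfl; simp at hb; exact hc0 hb.symm
  have hiff : ∀ a : K, a ^ (q + 1) = c ↔
      (Equiv.mulRight₀ b⁻¹ (inv_ne_zero hb0) a) ^ (q + 1) = 1 := by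
    intro a
    rw [Equiv.mulRight₀_apply, mul_pow, inv_pow, hb, mul_inv_eq_one₀ hc0]
  exact (Nat.card_congr (Equiv.subtypeEquiv _ hiff)).trans h.card_norm_eq_one

/-- The trace form of `K` over the fixed field of the involution is nondegenerate. -/
lemma exists_trace_ne_zero {t : K} (ht : t ≠ 0) : ∃ c : K, c * t + (c * t) ^ q ≠ 0 := by
  classical
  by_contra! hcon
  have := h.finite
  have := Fintype.ofFinite K
  have hq := h.one_lt
  have h1 : ∀ a : K, a + a ^ q = 0 := fun a => by
    simpa [div_mul_cancel₀ a ht] using hcon (a / t)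
  have h2 : (1 : K) + 1 = 0 := by simpa using h1 1
  have h3 : ∀ x : Kˣ, x ^ (q - 1) = 1 := by
    intro x
    refine Units.ext ?_
    rw [Units.val_pow_eq_pow_val, Units.val_one]
    refine mul_right_cancel₀ x.ne_zero ?_
    rw [← pow_succ, Nat.sub_add_cancel hq.le, one_mul]
    linear_combination h1 x - x * h2
  rw [FiniteField.forall_pow_eq_one_iff, ← Fintype.card_units, ← Nat.card_eq_fintype_card,
    h.card_units] at h3
  have h4 := Nat.le_of_dvd (by omega) h3
  nlinarith [Nat.sub_pos_of_lt hq]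

end IsQuadraticField

/-! ### The standard Hermitian form -/

section Hermitian

variable {q : ℕ} {K : Type*} [Field K] {n : ℕ}

lemma hermForm_add_left (x y z : Fin n → K) :
    hermForm q (x + y) z = hermForm q x z + hermForm q y z := by
  simp [hermForm, add_mul, Finset.sum_add_distrib]

lemma hermForm_smul_left (c : K) (x y : Fin n → K) :
    hermForm q (c • x) y = c * hermForm q x y := by
  simp [hermForm, Finset.mul_sum, mul_assoc]

lemma hermForm_zero_left (y : Fin n → K) : hermForm q 0 y = 0 := by simp [hermForm]

lemma hermForm_sub_left (x y z : Fin n → K) :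
    hermForm q (x - y) z = hermForm q x z - hermForm q y z := by
  simp [hermForm, sub_mul, Finset.sum_sub_distrib]

/-- The linear functional `⟨·, y⟩`. -/
def hermFunctional (q : ℕ) (y : Fin n → K) : (Fin n → K) →ₗ[K] K where
  toFun x := hermForm q x y
  map_add' x x' := hermForm_add_left x x' y
  map_smul' c x := hermForm_smul_left c x y

/-- The orthogonal complement with respect to the standard Hermitian form. -/
def hermOrth (q : ℕ) (W : Submodule K (Fin n → K)) : Submodule K (Fin n → K) where
  carrier := {x | ∀ w ∈ W, hermForm q x w = 0}
  zero_mem' w _ := hermForm_zero_left w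
  add_mem' hx hy w hw := by rw [hermForm_add_left, hx w hw, hy w hw, add_zero]
  smul_mem' c x hx w hw := by rw [hermForm_smul_left, hx w hw, mul_zero]

lemma mem_hermOrth {W : Submodule K (Fin n → K)} {x : Fin n → K} :
    x ∈ hermOrth q W ↔ ∀ w ∈ W, hermForm q x w = 0 := Iff.rfl

/-- The hyperplane orthogonal to a vector. -/
def hermPerp (q : ℕ) (e : Fin n → K) : Submodule K (Fin n → K) := LinearMap.ker (hermFunctional q e)

lemma mem_hermPerp {e x : Fin n → K} : x ∈ hermPerp q e ↔ hermForm q x e = 0 := Iff.rfl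

/-- The number of vectors of norm `1` in a subspace. -/
noncomputable def numUnit (q : ℕ) (W : Submodule K (Fin n → K)) : ℕ :=
  Nat.card {w : Fin n → K // w ∈ W ∧ hermForm q w w = 1}

/-- A subspace containing a unit vector `e` splits off the line of `e`. -/
noncomputable def splitUnit {W : Submodule K (Fin n → K)} {e : Fin n → K} (heW : e ∈ W)
    (he : hermForm q e e = 1) : W ≃ₗ[K] K × (W ⊓ hermPerp q e : Submodule K (Fin n → K)) where
  toFun x := (hermForm q x.1 e, ⟨x.1 - hermForm q x.1 e • e, W.sub_mem x.2 (W.smul_mem _ heW), by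
    rw [SetLike.mem_coe, mem_hermPerp, hermForm_sub_left, hermForm_smul_left, he, mul_one,
      sub_self]⟩)
  map_add' x y := by
    refine Prod.ext (hermForm_add_left _ _ _) (Subtype.ext ?_)
    simp only [Submodule.coe_add, hermForm_add_left, add_smul, Prod.snd_add]
    abel
  map_smul' c x := by
    refine Prod.ext (hermForm_smul_left _ _ _) (Subtype.ext ?_)
    simp only [Submodule.coe_smul, hermForm_smul_left, mul_smul, RingHom.id_apply, Prod.smul_snd,
      smul_sub]
  invFun p := ⟨p.1 • e + p.2.1, W.add_mem (W.smul_mem _ heW) p.2.2.1⟩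
  left_inv x := Subtype.ext (by simp)
  right_inv p := by
    have hp : hermForm q (p.1 • e + p.2.1) e = p.1 := by
      rw [hermForm_add_left, hermForm_smul_left, he, mem_hermPerp.1 p.2.2.2, mul_one, add_zero]
    refine Prod.ext hp (Subtype.ext ?_)
    change p.1 • e + p.2.1 - hermForm q (p.1 • e + p.2.1) e • e = p.2.1
    rw [hp, add_sub_cancel_left]

lemma finrank_inf_hermPerp {W : Submodule K (Fin n → K)} {e : Fin n → K} (heW : e ∈ W)
    (he : hermForm q e e = 1) :
    Module.finrank K W = 1 + Module.finrank K (W ⊓ hermPerp q e : Submodule K (Fin n → K)) := by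
  rw [(splitUnit heW he).finrank_eq, Module.finrank_prod, Module.finrank_self]

namespace IsQuadraticField

variable (h : IsQuadraticField q K)
include h

lemma hermForm_conj (x y : Fin n → K) : hermForm q x y ^ q = hermForm q y x := by
  rw [hermForm, h.sum_pow]
  refine Finset.sum_congr rfl fun i _ => ?_
  rw [mul_pow, h.pow_pow, mul_comm]

lemma hermForm_add_right (x y z : Fin n → K) :
    hermForm q x (y + z) = hermForm q x y + hermForm q x z := by
  simp only [← h.hermForm_conj _ x, hermForm_add_left, h.add_pow]

lemma hermForm_sub_right (x y z : Fin n → K) :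
    hermForm q x (y - z) = hermForm q x y - hermForm q x z := by
  simp only [← h.hermForm_conj _ x, hermForm_sub_left, h.sub_pow]

lemma hermForm_smul_right (c : K) (x y : Fin n → K) :
    hermForm q x (c • y) = c ^ q * hermForm q x y := by
  simp only [← h.hermForm_conj _ x, hermForm_smul_left, mul_pow]

lemma hermForm_eq_zero_comm {x y : Fin n → K} : hermForm q x y = 0 ↔ hermForm q y x = 0 := by
  rw [← h.hermForm_conj x y, pow_eq_zero_iff h.q_ne_zero]

lemma hermForm_single (x : Fin n → K) (i : Fin n) : hermForm q x (Pi.single i 1) = x i := by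
  rw [hermForm, Finset.sum_eq_single i]
  · simp
  · intro j _ hj
    simp [Pi.single_eq_of_ne hj, zero_pow h.q_ne_zero]
  · simp

lemma eq_zero_of_hermForm {x : Fin n → K} (hx : ∀ y, hermForm q x y = 0) : x = 0 :=
  funext fun i => by rw [← h.hermForm_single x i, hx, Pi.zero_apply]

lemma le_hermOrth_hermOrth (W : Submodule K (Fin n → K)) : W ≤ hermOrth q (hermOrth q W) :=
  fun _ hx _ hw => h.hermForm_eq_zero_comm.1 (hw _ hx)

lemma finrank_add_finrank_hermOrth (W : Submodule K (Fin n → K)) :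
    Module.finrank K W + Module.finrank K (hermOrth q W) = n := by
  have := h.finite
  -- The functionals `⟨·, w⟩` with `w ∈ W` form a subspace of the dual with as many elements as `W`.
  let D : Submodule K (Module.Dual K (Fin n → K)) :=
    { carrier := {f | ∃ w ∈ W, hermFunctional q w = f}
      zero_mem' := ⟨0, W.zero_mem, LinearMap.ext fun x =>
        h.hermForm_eq_zero_comm.1 (hermForm_zero_left x)⟩
      add_mem' := by
        rintro _ _ ⟨v, hv, rfl⟩ ⟨w, hw, rfl⟩
        exact ⟨v + w, W.add_mem hv hw, LinearMap.ext fun x => h.hermForm_add_right x v w⟩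
      smul_mem' := by
        rintro c _ ⟨v, hv, rfl⟩
        refine ⟨c ^ q • v, W.smul_mem _ hv, LinearMap.ext fun x => ?_⟩
        exact (h.hermForm_smul_right _ x v).trans (by rw [h.pow_pow]; rfl) }
  have hbij : Function.Bijective (fun w : W => (⟨hermFunctional q w.1, w.1, w.2, rfl⟩ : D)) := by
    constructor
    · intro v w hvw
      refine Subtype.ext (sub_eq_zero.1 (h.eq_zero_of_hermForm fun y => ?_))
      have := LinearMap.congr_fun (congrArg Subtype.val hvw) y
      rw [h.hermForm_eq_zero_comm, h.hermForm_sub_right, sub_eq_zero]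
      exact this
    · rintro ⟨_, w, hw, rfl⟩
      exact ⟨⟨w, hw⟩, rfl⟩
  have hcard : Nat.card W = Nat.card D := Nat.card_congr (Equiv.ofBijective _ hbij)
  rw [Module.natCard_eq_pow_finrank (K := K),
    Module.natCard_eq_pow_finrank (K := K) (V := D)] at hcard
  have hdim : Module.finrank K W = Module.finrank K D :=
    Nat.pow_right_injective Finite.one_lt_card hcard
  have hD : D.dualCoannihilator = hermOrth q W := by
    ext x
    rw [Submodule.mem_dualCoannihilator, mem_hermOrth]
    exact ⟨fun hx w hw => hx _ ⟨w, hw, rfl⟩, by rintro hx _ ⟨w, hw, rfl⟩; exact hx w hw⟩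
  rw [hdim, ← hD]
  simpa using Subspace.finrank_add_finrank_dualCoannihilator_eq D

lemma hermOrth_hermOrth (W : Submodule K (Fin n → K)) : hermOrth q (hermOrth q W) = W := by
  refine (Submodule.eq_of_le_of_finrank_eq (h.le_hermOrth_hermOrth W) ?_).symm
  have h1 := h.finrank_add_finrank_hermOrth W
  have h2 := h.finrank_add_finrank_hermOrth (hermOrth q W)
  omega

lemma hermForm_smul_add_self {e y : Fin n → K} (he : hermForm q e e = 1)
    (hy : hermForm q y e = 0) (a : K) :
    hermForm q (a • e + y) (a • e + y) = a ^ (q + 1) + hermForm q y y := by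
  rw [hermForm_add_left, h.hermForm_add_right, h.hermForm_add_right, hermForm_smul_left,
    hermForm_smul_left, h.hermForm_smul_right, h.hermForm_smul_right, he, hy,
    h.hermForm_eq_zero_comm.1 hy]
  ring

/-- Splitting off a unit vector: a vector `a • e + y` has norm `1` for one value of `a` if `y` has
norm `1`, and for `q + 1` values of `a` otherwise. -/
lemma numUnit_split {W : Submodule K (Fin n → K)} {e : Fin n → K} (heW : e ∈ W)
    (he : hermForm q e e = 1) :
    numUnit q W + q * numUnit q (W ⊓ hermPerp q e) =
      (q + 1) * Nat.card (W ⊓ hermPerp q e : Submodule K (Fin n → K)) := by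
  classical
  have := h.finite
  set W₁ := W ⊓ hermPerp q e
  have := Fintype.ofFinite W₁
  have e1 : numUnit q W = Nat.card (Σ y : W₁, {a : K // a ^ (q + 1) = 1 - hermForm q y.1 y.1}) := by
    have hto : ∀ p : Σ y : W₁, {a : K // a ^ (q + 1) = 1 - hermForm q y.1 y.1},
        hermForm q (p.2.1 • e + p.1.1) (p.2.1 • e + p.1.1) = 1 := by
      intro p
      rw [h.hermForm_smul_add_self he p.1.2.2, p.2.2, sub_add_cancel]
    have hinv : ∀ w : {w : Fin n → K // w ∈ W ∧ hermForm q w w = 1},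
        (splitUnit heW he ⟨w.1, w.2.1⟩).1 ^ (q + 1) =
          1 - hermForm q (splitUnit heW he ⟨w.1, w.2.1⟩).2.1
            (splitUnit heW he ⟨w.1, w.2.1⟩).2.1 := by
      intro w
      have e2 := congrArg Subtype.val ((splitUnit heW he).symm_apply_apply ⟨w.1, w.2.1⟩)
      have e4 := w.2.2
      rw [← e2] at e4
      rw [eq_sub_iff_add_eq, ← h.hermForm_smul_add_self he (splitUnit heW he ⟨w.1, w.2.1⟩).2.2.2]
      exact e4
    have happ : ∀ (y : W₁) (a : K),
        splitUnit heW he ⟨a • e + y.1, W.add_mem (W.smul_mem _ heW) y.2.1⟩ = (a, y) :=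
      fun y a => (splitUnit heW he).apply_symm_apply (a, y)
    refine (Nat.card_congr (Equiv.ofBijective
      (fun p => ⟨p.2.1 • e + p.1.1, W.add_mem (W.smul_mem _ heW) p.1.2.1, hto p⟩) ⟨?_, ?_⟩)).symm
    · rintro ⟨y, a, ha⟩ ⟨y', a', ha'⟩ hp
      have hv : a • e + y.1 = a' • e + y'.1 := congrArg Subtype.val hp
      have e2 : (a, y) = (a', y') := by
        rw [← happ y a, ← happ y' a']
        exact congrArg _ (Subtype.ext hv)
      rw [Prod.mk.injEq] at e2
      obtain ⟨rfl, rfl⟩ := e2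
      rfl
    · intro w
      have e2 := congrArg Subtype.val ((splitUnit heW he).symm_apply_apply ⟨w.1, w.2.1⟩)
      exact ⟨⟨(splitUnit heW he ⟨w.1, w.2.1⟩).2, (splitUnit heW he ⟨w.1, w.2.1⟩).1, hinv w⟩,
        Subtype.ext e2⟩
  have e2 : ∀ y : W₁, Nat.card {a : K // a ^ (q + 1) = 1 - hermForm q y.1 y.1} +
      q * (if hermForm q y.1 y.1 = 1 then 1 else 0) = q + 1 := by
    intro y
    split_ifs with hy
    · have : Nat.card {a : K // a ^ (q + 1) = 1 - hermForm q y.1 y.1} = 1 := by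
        rw [Nat.card_eq_one_iff_unique]
        refine ⟨⟨fun a b => Subtype.ext ?_⟩, ⟨⟨0, by simp [hy]⟩⟩⟩
        have ha : a.1 ^ (q + 1) = 0 := by simpa [hy] using a.2
        have hb : b.1 ^ (q + 1) = 0 := by simpa [hy] using b.2
        rw [pow_eq_zero_iff (by omega)] at ha hb
        rw [ha, hb]
      rw [this]
      ring
    · rw [h.card_norm_eq (sub_ne_zero.2 (Ne.symm hy))]
      · ring
      · rw [h.sub_pow, one_pow, h.hermForm_conj]
  have e3 : numUnit q W₁ = ∑ y : W₁, if hermForm q y.1 y.1 = 1 then 1 else 0 := by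
    rw [Finset.sum_boole, numUnit, Nat.cast_id, ← Fintype.card_subtype, ← Nat.card_eq_fintype_card]
    exact Nat.card_congr (Equiv.subtypeSubtypeEquivSubtypeInter _ _).symm
  rw [e1, e3, Nat.card_sigma, Finset.mul_sum, ← Finset.sum_add_distrib,
    Finset.sum_congr rfl fun y _ => e2 y, Finset.sum_const, Finset.card_univ, smul_eq_mul, mul_comm,
    Nat.card_eq_fintype_card]

lemma inf_hermOrth_split {W : Submodule K (Fin n → K)} {e : Fin n → K} (heW : e ∈ W)
    (he : hermForm q e e = 1) :
    (W ⊓ hermPerp q e) ⊓ hermOrth q (W ⊓ hermPerp q e) = W ⊓ hermOrth q W := by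
  ext x
  constructor
  · rintro ⟨⟨hxW, hxe⟩, hx⟩
    refine ⟨hxW, fun w hw => ?_⟩
    have e2 : hermForm q e w ^ q • e + (w - hermForm q e w ^ q • e) = w := add_sub_cancel _ _
    rw [← e2, h.hermForm_add_right, h.hermForm_smul_right, mem_hermPerp.1 hxe, mul_zero, zero_add]
    refine hx _ ⟨W.sub_mem hw (W.smul_mem _ heW), ?_⟩
    rw [SetLike.mem_coe, mem_hermPerp, hermForm_sub_left, hermForm_smul_left, he, h.hermForm_conj,
      mul_one, sub_self]
  · rintro ⟨hxW, hx⟩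
    exact ⟨⟨hxW, hx e heW⟩, fun w hw => hx w hw.1⟩

/-- A subspace without unit vectors is totally isotropic. -/
lemma le_hermOrth_of_no_unit {W : Submodule K (Fin n → K)}
    (hW : ∀ w ∈ W, hermForm q w w ≠ 1) : W ≤ hermOrth q W := by
  have h0 : ∀ w ∈ W, hermForm q w w = 0 := by
    intro w hw
    by_contra hc
    obtain ⟨a, ha⟩ := h.exists_norm_eq (inv_ne_zero hc) (by rw [inv_pow, h.hermForm_conj])
    refine hW _ (W.smul_mem a hw) ?_
    rw [hermForm_smul_left, h.hermForm_smul_right, ← mul_assoc, ← pow_succ', ha, inv_mul_cancel₀ hc]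
  intro x hx w hw
  by_contra hc
  obtain ⟨c, hc⟩ := h.exists_trace_ne_zero hc
  refine hc ?_
  have h1 := h0 (c • x + w) (W.add_mem (W.smul_mem c hx) hw)
  have h2 : hermForm q w (c • x) = (c * hermForm q x w) ^ q := by
    rw [← hermForm_smul_left, h.hermForm_conj]
  rw [hermForm_add_left, h.hermForm_add_right, h.hermForm_add_right, h0 _ (W.smul_mem c hx),
    h0 w hw, h2, hermForm_smul_left] at h1
  simpa using h1

/-- The number of unit vectors in a subspace depends only on its dimension and the dimension of its
radical. -/
lemma mul_numUnit (W : Submodule K (Fin n → K)) :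
    (q : ℝ) * numUnit q W = (q : ℝ) ^ (2 * Module.finrank K W) -
      (-(q : ℝ)) ^ (Module.finrank K W +
        Module.finrank K (W ⊓ hermOrth q W : Submodule K (Fin n → K))) := by
  have := h.finite
  induction hk : Module.finrank K W generalizing W with
  | zero =>
    have : W = ⊥ := Submodule.finrank_eq_zero.1 hk
    subst this
    have : IsEmpty {w : Fin n → K // w ∈ (⊥ : Submodule K (Fin n → K)) ∧ hermForm q w w = 1} := by
      refine ⟨fun w => ?_⟩
      have h1 := w.2.2
      rw [(Submodule.mem_bot K).1 w.2.1, hermForm_zero_left] at h1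
      exact zero_ne_one h1
    rw [bot_inf_eq, numUnit, Nat.card_of_isEmpty]
    simp
  | succ k ih =>
    by_cases hW : ∃ e ∈ W, hermForm q e e = 1
    · obtain ⟨e, heW, he⟩ := hW
      have h1 := finrank_inf_hermPerp heW he
      have h2 := ih (W ⊓ hermPerp q e) (by omega)
      have h3 := h.numUnit_split heW he
      rw [Module.natCard_eq_pow_finrank (K := K), h.card, show Module.finrank K
        (W ⊓ hermPerp q e : Submodule K (Fin n → K)) = k by omega] at h3
      rw [h.inf_hermOrth_split heW he] at h2
      have h4 : (numUnit q W : ℝ) + q * numUnit q (W ⊓ hermPerp q e) =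
          (q + 1) * ((q : ℝ) ^ 2) ^ k := by
        exact_mod_cast h3
      have h5 : (-(q : ℝ)) ^ (k + 1 + Module.finrank K
          (W ⊓ hermOrth q W : Submodule K (Fin n → K))) = -(q : ℝ) * (-(q : ℝ)) ^ (k +
          Module.finrank K (W ⊓ hermOrth q W : Submodule K (Fin n → K))) := by ring
      rw [h5, mul_add, pow_add, mul_one, pow_mul]
      rw [pow_mul] at h2
      linear_combination (q : ℝ) * h4 - (q : ℝ) * h2
    · push Not at hW
      have : IsEmpty {w : Fin n → K // w ∈ W ∧ hermForm q w w = 1} :=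
        ⟨fun w => hW w.1 w.2.1 w.2.2⟩
      rw [inf_eq_left.2 (h.le_hermOrth_of_no_unit hW), hk, ← two_mul, pow_mul, pow_mul, neg_sq,
        sub_self, numUnit]
      simp

/-- The number of all unit vectors. -/
lemma mul_numUnit_top :
    (q : ℝ) * numUnit q (⊤ : Submodule K (Fin n → K)) = (q : ℝ) ^ (2 * n) - (-(q : ℝ)) ^ n := by
  rw [h.mul_numUnit]
  have h1 : hermOrth q (⊤ : Submodule K (Fin n → K)) = ⊥ := by
    rw [eq_bot_iff]
    intro x hx
    exact (Submodule.mem_bot K).2 (h.eq_zero_of_hermForm fun y => hx y trivial)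
  rw [h1, inf_bot_eq]
  simp

/-- Duality between the numbers of unit vectors in a subspace and in its orthogonal complement. -/
lemma mul_numUnit_hermOrth (W : Submodule K (Fin n → K)) :
    (q : ℝ) ^ (2 * Module.finrank K W) * (q * numUnit q (hermOrth q W)) =
      (q : ℝ) ^ (2 * n) - (-(q : ℝ)) ^ n * ((q : ℝ) ^ (2 * Module.finrank K W) -
        q * numUnit q W) := by
  have h1 := h.finrank_add_finrank_hermOrth W
  have h2 : (q : ℝ) ^ (2 * n) =
      (q : ℝ) ^ (2 * (Module.finrank K W + Module.finrank K (hermOrth q W))) := by rw [h1]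
  have h3 : (-(q : ℝ)) ^ n =
      (-(q : ℝ)) ^ (Module.finrank K W + Module.finrank K (hermOrth q W)) := by rw [h1]
  rw [h.mul_numUnit W, h.mul_numUnit (hermOrth q W), h.hermOrth_hermOrth, inf_comm, h2, h3]
  have hq2 : ∀ m, (q : ℝ) ^ (2 * m) = (-(q : ℝ)) ^ (2 * m) := fun m => by
    rw [pow_mul, pow_mul, neg_sq]
  simp only [hq2]
  ring

end IsQuadraticField

end Hermitian

/-! ### Unitary groups and quasi-reflections -/

section Unitary

variable {q : ℕ} {K : Type*} [Field K] {n : ℕ}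

lemma hermForm_colMap (g : unitaryGrp q K n) (x y : Fin n → K) :
    hermForm q (colMap g.1 x) (colMap g.1 y) = hermForm q x y := g.2 x y

lemma unitary_ext {g g' : unitaryGrp q K n} (hg : ∀ x, colMap g.1 x = colMap g'.1 x) : g = g' :=
  Subtype.ext (colMap_injective (LinearMap.ext hg))

/-- The quasi-reflection `x ↦ x + c ⟨x, u⟩ u`. -/
def quasiReflection (q : ℕ) (c : K) (u : Fin n → K) : (Fin n → K) →ₗ[K] (Fin n → K) :=
  LinearMap.id + c • (hermFunctional q u).smulRight u

lemma quasiReflection_apply (c : K) (u x : Fin n → K) :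
    quasiReflection q c u x = x + (c * hermForm q x u) • u := by
  simp [quasiReflection, hermFunctional, mul_smul]

/-- If some vector fixed by `c` is not orthogonal to `e`, then composing `c` with a nontrivial
reflection along `e` cuts the fixed space down to its intersection with `e^⊥`. -/
lemma fixedSpace_reflection_mul {e : Fin n → K} {c g : unitaryGrp q K n} {a : K} (ha : a ≠ 0)
    (hg : ∀ x, colMap g.1 x = colMap c.1 x + (a * hermForm q (colMap c.1 x) e) • e)
    (hc : e ∉ hermOrth q (fixedSpace c.1)) :
    fixedSpace g.1 = fixedSpace c.1 ⊓ hermPerp q e := by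
  rw [mem_hermOrth] at hc
  push Not at hc
  obtain ⟨x, hx, hex⟩ := hc
  ext y
  rw [Submodule.mem_inf, mem_fixedSpace, mem_fixedSpace, mem_hermPerp, hg]
  constructor
  · intro hy
    have h1 := hermForm_colMap c y x
    rw [mem_fixedSpace.1 hx] at h1
    have h2 := congrArg (fun z => hermForm q z x) hy
    simp only [hermForm_add_left, hermForm_smul_left, h1] at h2
    have h3 : hermForm q (colMap c.1 y) e = 0 := by
      have : a * hermForm q (colMap c.1 y) e * hermForm q e x = 0 := by linear_combination h2
      simpa [ha, hex] using this
    rw [h3, mul_zero, zero_smul, add_zero] at hy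
    exact ⟨hy, by rwa [hy] at h3⟩
  · rintro ⟨hy, hye⟩
    rw [hy, hye, mul_zero, zero_smul, add_zero]

namespace IsQuadraticField

variable (h : IsQuadraticField q K)
include h

lemma exists_unitary_eq (T : (Fin n → K) →ₗ[K] (Fin n → K))
    (hT : ∀ x y, hermForm q (T x) (T y) = hermForm q x y) :
    ∃ g : unitaryGrp q K n, colMap g.1 = T := by
  have hinj : Function.Injective T := by
    intro x y hxy
    refine sub_eq_zero.1 (h.eq_zero_of_hermForm fun z => ?_)
    rw [← hT, map_sub, hxy, sub_self, hermForm_zero_left]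
  obtain ⟨g, hg⟩ := exists_colMap_eq T hinj
  refine ⟨⟨g, fun x y => ?_⟩, hg⟩
  have := hT x y
  rw [← hg] at this
  exact this

lemma exists_unitary_quasiReflection {c : K} {u : Fin n → K}
    (hc : c + c ^ q + c * c ^ q * hermForm q u u = 0) :
    ∃ g : unitaryGrp q K n, ∀ x, colMap g.1 x = x + (c * hermForm q x u) • u := by
  obtain ⟨g, hg⟩ := h.exists_unitary_eq (quasiReflection q c u) (by
    intro x y
    rw [quasiReflection_apply, quasiReflection_apply, hermForm_add_left, h.hermForm_add_right,
      h.hermForm_add_right, hermForm_smul_left, hermForm_smul_left, h.hermForm_smul_right,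
      h.hermForm_smul_right, mul_pow, h.hermForm_conj]
    linear_combination (hermForm q x u * hermForm q u y) * hc)
  exact ⟨g, fun x => by rw [hg, quasiReflection_apply]⟩

/-- A unitary reflection: it multiplies the unit vector `e` by `μ` and fixes `e^⊥`. -/
lemma exists_reflection {e : Fin n → K} (he : hermForm q e e = 1) {μ : K} (hμ : μ ^ (q + 1) = 1) :
    ∃ g : unitaryGrp q K n, ∀ x, colMap g.1 x = x + ((μ - 1) * hermForm q x e) • e := by
  refine h.exists_unitary_quasiReflection ?_
  rw [he, h.sub_pow, one_pow]
  linear_combination hμ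

lemma exists_unitary_map_unit {e v : Fin n → K} (he : hermForm q e e = 1)
    (hv : hermForm q v v = 1) : ∃ g : unitaryGrp q K n, colMap g.1 e = v := by
  have := h.finite
  have hq := h.one_lt
  -- Some multiple `w = μ • v` by a scalar of norm one satisfies `⟨e, w⟩ ≠ 1`; then a
  -- quasi-reflection along `w - e` takes `e` to `w`.
  obtain ⟨μ, hμ, hμ1⟩ : ∃ μ : K, μ ^ (q + 1) = 1 ∧ hermForm q e (μ • v) ≠ 1 := by
    by_contra! hcon
    have hsub : Subsingleton {μ : K // μ ^ (q + 1) = 1} := by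
      refine ⟨fun a b => Subtype.ext ?_⟩
      have ha := hcon a.1 a.2
      have hb := hcon b.1 b.2
      rw [h.hermForm_smul_right] at ha hb
      have h0 : hermForm q e v ≠ 0 := by
        intro h0
        rw [h0, mul_zero] at ha
        exact zero_ne_one ha
      rw [← h.pow_pow a.1, ← h.pow_pow b.1, mul_right_cancel₀ h0 (ha.trans hb.symm)]
    have h1 := h.card_norm_eq_one
    have h2 := Finite.card_le_one_iff_subsingleton.2 hsub
    omega
  have hμ0 : μ ≠ 0 := by rintro rfl; simp at hμ
  set w := μ • v with hw
  have hww : hermForm q w w = 1 := by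
    rw [hw, hermForm_smul_left, h.hermForm_smul_right, hv, mul_one, ← pow_succ', hμ]
  have hs : hermForm q e w - 1 ≠ 0 := sub_ne_zero.2 hμ1
  obtain ⟨g, hg⟩ := h.exists_unitary_quasiReflection (c := (hermForm q e w - 1)⁻¹) (u := w - e) (by
    have hs' : hermForm q w e - 1 ≠ 0 := by
      rw [← h.hermForm_conj e w, ← one_pow q, ← h.sub_pow]
      exact pow_ne_zero _ hs
    rw [inv_pow, h.sub_pow, one_pow, h.hermForm_conj, hermForm_sub_left, h.hermForm_sub_right,
      h.hermForm_sub_right, hww, he]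
    field_simp
    ring)
  obtain ⟨d, hd⟩ := h.exists_unitary_eq (n := n) (μ⁻¹ • LinearMap.id) (by
    intro x y
    simp only [LinearMap.smul_apply, LinearMap.id_apply]
    rw [hermForm_smul_left, h.hermForm_smul_right, ← mul_assoc, ← pow_succ', inv_pow, hμ, inv_one,
      one_mul])
  refine ⟨d * g, ?_⟩
  rw [Subgroup.coe_mul, colMap_mul, hg, h.hermForm_sub_right, he, inv_mul_cancel₀ hs, one_smul,
    add_sub_cancel, hd, hw]
  simp [smul_smul, hμ0]

/-! ### Cosets of the group of reflections along a unit vector -/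

/-- The image of `g - 1` is the orthogonal complement of the fixed space. -/
lemma exists_sub_eq_of_mem_hermOrth (g : unitaryGrp q K n) {e : Fin n → K}
    (he : e ∈ hermOrth q (fixedSpace g.1)) : ∃ x, colMap g.1 x - x = e := by
  have hle : LinearMap.range (colMap g.1 - LinearMap.id) ≤ hermOrth q (fixedSpace g.1) := by
    rintro _ ⟨x, rfl⟩ w hw
    have h1 := hermForm_colMap g x w
    rw [mem_fixedSpace.1 hw] at h1
    rw [LinearMap.sub_apply, hermForm_sub_left, h1, LinearMap.id_apply, sub_self]
  have heq := Submodule.eq_of_le_of_finrank_eq hle (by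
    have h1 : Module.finrank K (colMap g.1).fixedSubmodule +
        Module.finrank K (hermOrth q (fixedSpace g.1)) = n :=
      h.finrank_add_finrank_hermOrth (fixedSpace g.1)
    have h2 := LinearMap.finrank_range_add_finrank_ker (colMap g.1 - LinearMap.id)
    rw [← LinearMap.fixedSubmodule_eq_ker, Module.finrank_fin_fun] at h2
    omega)
  rw [← heq] at he
  exact he

lemma finrank_inf_hermPerp_add_one {W : Submodule K (Fin n → K)} {e : Fin n → K}
    (he : e ∉ hermOrth q W) :
    Module.finrank K (W ⊓ hermPerp q e : Submodule K (Fin n → K)) + 1 = Module.finrank K W := by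
  have hne : (hermFunctional q e).domRestrict W ≠ 0 := by
    intro h0
    refine he fun w hw => h.hermForm_eq_zero_comm.1 ?_
    exact LinearMap.congr_fun h0 ⟨w, hw⟩
  have h1 := Module.Dual.finrank_ker_add_one_of_ne_zero hne
  rw [← h1]
  congr 1
  have h2 : (LinearMap.ker ((hermFunctional q e).domRestrict W)).map W.subtype =
      W ⊓ hermPerp q e := by
    ext x
    constructor
    · rintro ⟨y, hy, rfl⟩
      exact ⟨y.2, hy⟩
    · rintro ⟨hx, hxe⟩
      exact ⟨⟨x, hx⟩, hxe, rfl⟩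
  rw [← h2]
  exact Submodule.finrank_map_subtype_eq _ _

/-- In each coset of the group of reflections along `e`, one element has a fixed space that is not
orthogonal to `e`; the other `q` elements fix the intersection of that space with `e^⊥`. -/
lemma sum_hermOrth_eq [Fintype (unitaryGrp q K n)] {e : Fin n → K} (he : hermForm q e e = 1)
    (f : ℕ → ℝ) [DecidablePred fun g : unitaryGrp q K n => e ∈ hermOrth q (fixedSpace g.1)] :
    ∑ g : unitaryGrp q K n, (if e ∈ hermOrth q (fixedSpace g.1) then f (fixedDim g.1 + 1) else 0) =
      q * ∑ g : unitaryGrp q K n,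
        (if e ∈ hermOrth q (fixedSpace g.1) then 0 else f (fixedDim g.1)) := by
  classical
  have := h.finite
  have := Fintype.ofFinite K
  choose! d hd using fun μ (hμ : μ ^ (q + 1) = 1) => h.exists_reflection he hμ
  let A := {g : unitaryGrp q K n // e ∈ hermOrth q (fixedSpace g.1)}
  let C := {g : unitaryGrp q K n // e ∉ hermOrth q (fixedSpace g.1)}
  let Λ := {μ : K // μ ^ (q + 1) = 1 ∧ μ ≠ 1}
  have hΛ : Fintype.card Λ = q := by
    have h1 := h.card_norm_eq_one
    rw [Nat.card_eq_fintype_card, Fintype.card_subtype] at h1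
    have h2 : Finset.univ.filter (fun μ : K => μ ^ (q + 1) = 1 ∧ μ ≠ 1) =
        (Finset.univ.filter fun μ : K => μ ^ (q + 1) = 1).erase 1 := by
      ext μ
      simp [and_comm]
    rw [Fintype.card_subtype, h2, Finset.card_erase_of_mem (by simp), h1, Nat.add_sub_cancel]
  have hmul : ∀ (μ : K), μ ^ (q + 1) = 1 → ∀ (c : unitaryGrp q K n) (x : Fin n → K),
      colMap (d μ * c).1 x = colMap c.1 x + ((μ - 1) * hermForm q (colMap c.1 x) e) • e := by
    intro μ hμ c x
    rw [Subgroup.coe_mul, colMap_mul, hd μ hμ]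
  have hdd : ∀ μ ν : K, μ ^ (q + 1) = 1 → ν ^ (q + 1) = 1 → d μ * d ν = d (μ * ν) := by
    intro μ ν hμ hν
    refine unitary_ext fun x => ?_
    rw [hmul μ hμ, hd ν hν, hd (μ * ν) (by rw [mul_pow, hμ, hν, one_mul]), hermForm_add_left,
      hermForm_smul_left, he, add_assoc, ← add_smul]
    congr 2
    ring
  have hd1 : d 1 = 1 := by
    refine unitary_ext fun x => ?_
    rw [hd 1 (one_pow _)]
    simp
  have hfix : ∀ (c : C) (μ : Λ),
      fixedSpace (d μ.1 * c.1).1 = fixedSpace c.1.1 ⊓ hermPerp q e := fun c μ =>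
    fixedSpace_reflection_mul (sub_ne_zero.2 μ.2.2) (hmul μ.1 μ.2.1 c.1) c.2
  have hmem : ∀ (c : C) (μ : Λ), e ∈ hermOrth q (fixedSpace (d μ.1 * c.1).1) := by
    intro c μ
    rw [hfix]
    exact fun w hw => h.hermForm_eq_zero_comm.1 hw.2
  let Φ : C × Λ → A := fun p => ⟨d p.2.1 * p.1.1, hmem p.1 p.2⟩
  have hinj : Function.Injective Φ := by
    rintro ⟨c, μ⟩ ⟨c', μ'⟩ hp
    have h1 : d μ.1 * c.1 = d μ'.1 * c'.1 := congrArg Subtype.val hp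
    have hinv : μ'.1⁻¹ ^ (q + 1) = 1 := by rw [inv_pow, μ'.2.1, inv_one]
    have hμ0 : μ'.1 ≠ 0 := by
      intro h0
      have := μ'.2.1
      rw [h0] at this
      simp at this
    have h2 : c'.1 = d (μ'.1⁻¹ * μ.1) * c.1 := by
      rw [← hdd _ _ hinv μ.2.1, mul_assoc, h1, ← mul_assoc, hdd _ _ hinv μ'.2.1,
        inv_mul_cancel₀ hμ0, hd1, one_mul]
    have h3 : μ'.1⁻¹ * μ.1 = 1 := by
      by_contra hne
      refine c'.2 ?_
      rw [h2]
      exact hmem c ⟨_, by rw [mul_pow, hinv, μ.2.1, one_mul], hne⟩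
    have h4 : μ = μ' := Subtype.ext ((inv_mul_eq_one₀ hμ0).1 h3).symm
    rw [h3, hd1, one_mul] at h2
    rw [h4, Subtype.ext h2]
  have hsurj : Function.Surjective Φ := by
    rintro ⟨g, hg⟩
    obtain ⟨x, hx⟩ := h.exists_sub_eq_of_mem_hermOrth g hg
    have hgx : colMap g.1 x = x + e := by rw [← hx, add_sub_cancel]
    -- With `t = ⟨x, e⟩`, invariance of the norm of `x` says `t + t ^ q = -1`; the reflection by
    -- `-t / t ^ q` takes `x + e = g x` back to `x`.
    set t := hermForm q x e with ht
    have htr : t + t ^ q = -1 := by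
      have h1 := hermForm_colMap g x x
      rw [hgx, hermForm_add_left, h.hermForm_add_right, h.hermForm_add_right, he,
        ← h.hermForm_conj x e] at h1
      linear_combination h1
    have ht0 : t ≠ 0 := by
      intro h0
      rw [h0, zero_pow h.q_ne_zero, add_zero] at htr
      exact one_ne_zero (neg_eq_zero.1 htr.symm)
    have htq0 : t ^ q ≠ 0 := pow_ne_zero _ ht0
    set μ : K := -t / t ^ q with hμ
    have hμ1 : μ ^ (q + 1) = 1 := by
      rw [pow_succ, hμ, div_pow, h.neg_pow, h.pow_pow]
      field_simp
    have hμ0 : μ ≠ 0 := div_ne_zero (neg_ne_zero.2 ht0) htq0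
    have hinv : μ⁻¹ ^ (q + 1) = 1 := by rw [inv_pow, hμ1, inv_one]
    have hμne : μ ≠ 1 := by
      intro h1
      rw [hμ, div_eq_one_iff_eq htq0] at h1
      rw [← h1, add_neg_cancel] at htr
      exact one_ne_zero (neg_eq_zero.1 htr.symm)
    have hfx : colMap (d μ * g).1 x = x := by
      have h1 : (μ - 1) * (t + 1) = -1 := by
        have h2 : t + 1 = -t ^ q := by linear_combination htr
        rw [h2, hμ, sub_mul, div_mul_eq_mul_div]
        field_simp
        linear_combination htr
      rw [hmul μ hμ1, hgx, hermForm_add_left, ← ht, he, h1, neg_smul, one_smul,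
        add_neg_cancel_right]
    have hc : e ∉ hermOrth q (fixedSpace (d μ * g).1) := by
      intro hmem'
      exact ht0 (h.hermForm_eq_zero_comm.1 (hmem' x (mem_fixedSpace.2 hfx)))
    refine ⟨(⟨d μ * g, hc⟩, ⟨μ⁻¹, hinv, fun h1 => hμne (inv_eq_one.1 h1)⟩), Subtype.ext ?_⟩
    change d μ⁻¹ * (d μ * g) = g
    rw [← mul_assoc, hdd _ _ hinv hμ1, inv_mul_cancel₀ hμ0, hd1, one_mul]
  have hsum : ∑ p : C × Λ, f (fixedDim p.1.1.1) = ∑ g : A, f (fixedDim g.1.1 + 1) := by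
    refine Fintype.sum_bijective Φ ⟨hinj, hsurj⟩ _ _ fun p => ?_
    have h1 : fixedDim (d p.2.1 * p.1.1).1 + 1 = fixedDim p.1.1.1 := by
      rw [fixedDim_eq, hfix, h.finrank_inf_hermPerp_add_one p.1.2, fixedDim_eq]
    rw [← h1]
  have hA : ∑ g : unitaryGrp q K n,
      (if e ∈ hermOrth q (fixedSpace g.1) then f (fixedDim g.1 + 1) else 0) =
        ∑ g : A, f (fixedDim g.1.1 + 1) := by
    rw [← Finset.sum_filter]
    exact Finset.sum_subtype _ (by simp) _
  have hC : ∑ g : unitaryGrp q K n,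
      (if e ∈ hermOrth q (fixedSpace g.1) then 0 else f (fixedDim g.1)) =
        ∑ g : C, f (fixedDim g.1.1) := by
    simp_rw [← ite_not (p := e ∈ _)]
    rw [← Finset.sum_filter]
    exact Finset.sum_subtype _ (by simp) _
  rw [hA, hC, ← hsum, Fintype.sum_prod_type, Finset.mul_sum]
  refine Finset.sum_congr rfl fun c _ => ?_
  have h1 : ∑ _μ : Λ, f (fixedDim c.1.1) = q * f (fixedDim c.1.1) := by
    rw [Finset.sum_const, Finset.card_univ, hΛ, nsmul_eq_mul]
  exact h1

/-- The coset count summed over all unit vectors. -/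
lemma sum_numUnit_hermOrth [Fintype (unitaryGrp q K n)] (f : ℕ → ℝ) :
    ∑ g : unitaryGrp q K n, f (fixedDim g.1 + 1) * numUnit q (hermOrth q (fixedSpace g.1)) =
      q * ∑ g : unitaryGrp q K n, f (fixedDim g.1) *
        (numUnit q (⊤ : Submodule K (Fin n → K)) - numUnit q (hermOrth q (fixedSpace g.1))) := by
  classical
  have := h.finite
  let E := {e : Fin n → K // hermForm q e e = 1}
  have := Fintype.ofFinite E
  have hU : ∀ W : Submodule K (Fin n → K),
      (numUnit q W : ℝ) = ∑ e : E, if e.1 ∈ W then 1 else 0 := by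
    intro W
    rw [Finset.sum_boole, numUnit, ← Fintype.card_subtype, ← Nat.card_eq_fintype_card]
    refine congrArg Nat.cast (Nat.card_congr ?_)
    exact ((Equiv.subtypeSubtypeEquivSubtypeInter _ _).trans
      (Equiv.subtypeEquivRight fun x => and_comm)).symm
  have hU' : ∀ W : Submodule K (Fin n → K),
      (numUnit q (⊤ : Submodule K (Fin n → K)) : ℝ) - numUnit q W =
        ∑ e : E, if e.1 ∈ W then 0 else 1 := by
    intro W
    rw [hU, hU, ← Finset.sum_sub_distrib]
    refine Finset.sum_congr rfl fun e _ => ?_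
    split_ifs <;> simp_all
  simp only [hU']
  simp only [hU (hermOrth q _), Finset.mul_sum, mul_ite, mul_one, mul_zero]
  rw [Finset.sum_comm, Finset.sum_comm (s := Finset.univ (α := unitaryGrp q K n))]
  refine Finset.sum_congr rfl fun e _ => ?_
  rw [h.sum_hermOrth_eq e.2 f, Finset.mul_sum]
  refine Finset.sum_congr rfl fun g _ => ?_
  split_ifs <;> simp

end IsQuadraticField

end Unitary

/-! ### The stabilizer of a unit vector -/

section Stabilizer

variable {q : ℕ} {K : Type*} [Field K] {n : ℕ}

/-- The action of the unitary group on the vectors of norm `1`. -/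
abbrev unitAction (q : ℕ) (K : Type*) [Field K] (n : ℕ) :
    MulAction (unitaryGrp q K n) {v : Fin n → K // hermForm q v v = 1} where
  smul g v := ⟨colMap g.1 v.1, (hermForm_colMap g v.1 v.1).trans v.2⟩
  one_smul v := Subtype.ext (colMap_one v.1)
  mul_smul g h v := Subtype.ext (colMap_mul g.1 h.1 v.1)

lemma hermForm_cons (a b : K) (x y : Fin n → K) :
    hermForm q (Fin.cons a x : Fin (n + 1) → K) (Fin.cons b y) = a * b ^ q + hermForm q x y := by
  simp [hermForm, Fin.sum_univ_succ]

/-- The block sum of `1` and a linear map. -/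
def consMap (T : (Fin n → K) →ₗ[K] (Fin n → K)) : (Fin (n + 1) → K) →ₗ[K] (Fin (n + 1) → K) where
  toFun x := Fin.cons (x 0) (T (Fin.tail x))
  map_add' x y := by
    have : Fin.tail (x + y) = Fin.tail x + Fin.tail y := rfl
    rw [this, map_add]
    funext i
    refine Fin.cases ?_ (fun j => ?_) i <;> simp
  map_smul' c x := by
    have : Fin.tail (c • x) = c • Fin.tail x := rfl
    rw [this, map_smul]
    funext i
    refine Fin.cases ?_ (fun j => ?_) i <;> simp

/-- The compression of a linear map to the last `n` coordinates. -/
def tailMap (T : (Fin (n + 1) → K) →ₗ[K] (Fin (n + 1) → K)) : (Fin n → K) →ₗ[K] (Fin n → K) where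
  toFun y := Fin.tail (T (Fin.cons 0 y))
  map_add' x y := by
    have : (Fin.cons 0 (x + y) : Fin (n + 1) → K) = Fin.cons 0 x + Fin.cons 0 y := by
      funext i
      refine Fin.cases ?_ (fun j => ?_) i <;> simp
    rw [this, map_add]
    rfl
  map_smul' c x := by
    have : (Fin.cons 0 (c • x) : Fin (n + 1) → K) = c • Fin.cons 0 x := by
      funext i
      refine Fin.cases ?_ (fun j => ?_) i <;> simp
    rw [this, map_smul]
    rfl

lemma fixedDim_consMap {g : GL (Fin (n + 1)) K} {k : GL (Fin n) K}
    (hg : colMap g = consMap (colMap k)) : fixedDim g = fixedDim k + 1 := by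
  have hmem : ∀ x, x ∈ fixedSpace g ↔ Fin.tail x ∈ fixedSpace k := by
    intro x
    rw [mem_fixedSpace, mem_fixedSpace, hg]
    change (Fin.cons (x 0) (colMap k (Fin.tail x)) : Fin (n + 1) → K) = x ↔ _
    constructor
    · intro hx
      have := congrArg Fin.tail hx
      rwa [Fin.tail_cons] at this
    · intro hx
      rw [hx, Fin.cons_self_tail]
  let Ψ : fixedSpace g ≃ₗ[K] K × fixedSpace k :=
    { toFun := fun x => (x.1 0, ⟨Fin.tail x.1, (hmem x.1).1 x.2⟩)
      map_add' := fun x y => rfl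
      map_smul' := fun c x => rfl
      invFun := fun p => ⟨Fin.cons p.1 p.2.1, (hmem _).2 (by rw [Fin.tail_cons]; exact p.2.2)⟩
      left_inv := fun x => Subtype.ext (Fin.cons_self_tail x.1)
      right_inv := fun p => rfl }
  rw [fixedDim_eq, Ψ.finrank_eq, Module.finrank_prod, Module.finrank_self, fixedDim_eq, add_comm]

lemma numUnit_top_eq : numUnit q (⊤ : Submodule K (Fin n → K)) =
    Nat.card {v : Fin n → K // hermForm q v v = 1} :=
  Nat.card_congr (Equiv.subtypeEquivRight fun v => by simp)

namespace IsQuadraticField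

variable (h : IsQuadraticField q K)
include h

lemma unitAction_isPretransitive :
    letI := unitAction q K n
    MulAction.IsPretransitive (unitaryGrp q K n) {v : Fin n → K // hermForm q v v = 1} := by
  let := unitAction q K n
  refine ⟨fun e v => ?_⟩
  obtain ⟨g, hg⟩ := h.exists_unitary_map_unit e.2 v.2
  exact ⟨g, Subtype.ext hg⟩

/-- The stabilizer of the first basis vector is the unitary group in dimension one less. -/
lemma exists_equiv_stabilizer (e₀ : {v : Fin (n + 1) → K // hermForm q v v = 1})
    (he₀ : e₀.1 = Pi.single 0 1) :
    letI := unitAction q K (n + 1)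
    ∃ Ψ : unitaryGrp q K n ≃ MulAction.stabilizer (unitaryGrp q K (n + 1)) e₀,
      ∀ k, fixedDim (Ψ k).1.1 = fixedDim k.1 + 1 := by
  let := unitAction q K (n + 1)
  have hex : ∀ k : unitaryGrp q K n, ∃ g : unitaryGrp q K (n + 1),
      colMap g.1 = consMap (colMap k.1) := by
    intro k
    refine h.exists_unitary_eq _ fun x y => ?_
    change hermForm q (Fin.cons (x 0) (colMap k.1 (Fin.tail x)) : Fin (n + 1) → K)
      (Fin.cons (y 0) (colMap k.1 (Fin.tail y))) = _
    rw [hermForm_cons, hermForm_colMap, ← hermForm_cons, Fin.cons_self_tail, Fin.cons_self_tail]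
  choose ψ hψ using hex
  have hsingle : (Pi.single 0 1 : Fin (n + 1) → K) = Fin.cons 1 0 := by
    funext i
    refine Fin.cases ?_ (fun j => ?_) i <;> simp
  have hstab : ∀ k, ψ k ∈ MulAction.stabilizer (unitaryGrp q K (n + 1)) e₀ := by
    intro k
    refine Subtype.ext ?_
    change colMap (ψ k).1 e₀.1 = e₀.1
    rw [hψ, he₀, hsingle]
    change (Fin.cons 1 (colMap k.1 0) : Fin (n + 1) → K) = _
    rw [map_zero]
  refine ⟨Equiv.ofBijective (fun k => ⟨ψ k, hstab k⟩) ⟨?_, ?_⟩, fun k => fixedDim_consMap (hψ k)⟩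
  · intro k k' hk
    have h1 : ψ k = ψ k' := congrArg Subtype.val hk
    refine unitary_ext fun y => ?_
    have h2 : consMap (colMap k.1) (Fin.cons 0 y) = consMap (colMap k'.1) (Fin.cons 0 y) := by
      rw [← hψ, ← hψ, h1]
    exact congrArg Fin.tail h2
  · rintro ⟨g, hg⟩
    have hge : colMap g.1 (Pi.single 0 1) = Pi.single 0 1 := by
      have := congrArg Subtype.val (MulAction.mem_stabilizer_iff.1 hg)
      rw [he₀.symm]
      exact this
    have hg0 : ∀ y : Fin n → K,
        colMap g.1 (Fin.cons 0 y) = Fin.cons 0 (tailMap (colMap g.1) y) := by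
      intro y
      have h1 := hermForm_colMap g (Fin.cons 0 y) (Pi.single 0 1)
      rw [hge, h.hermForm_single, h.hermForm_single, Fin.cons_zero] at h1
      have h2 := (Fin.cons_self_tail (colMap g.1 (Fin.cons 0 y))).symm
      rw [h1] at h2
      exact h2
    obtain ⟨k, hk⟩ := h.exists_unitary_eq (tailMap (colMap g.1)) (by
      intro x y
      have h1 := hermForm_colMap g (Fin.cons 0 x) (Fin.cons 0 y)
      rw [hg0, hg0, hermForm_cons, hermForm_cons, zero_mul, zero_add, zero_add] at h1
      exact h1)
    refine ⟨k, Subtype.ext (unitary_ext fun x => ?_)⟩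
    change colMap (ψ k).1 x = colMap g.1 x
    have hx : x = x 0 • (Pi.single 0 1 : Fin (n + 1) → K) + Fin.cons 0 (Fin.tail x) := by
      funext i
      refine Fin.cases ?_ (fun j => ?_) i <;> simp [Fin.tail]
    conv_rhs => rw [hx, map_add, map_smul, hge, hg0]
    rw [hψ, hk]
    change (Fin.cons (x 0) (tailMap (colMap g.1) (Fin.tail x)) : Fin (n + 1) → K) = _
    funext i
    refine Fin.cases ?_ (fun j => ?_) i <;> simp

lemma card_unitaryGrp_succ : Nat.card (unitaryGrp q K (n + 1)) =
    numUnit q (⊤ : Submodule K (Fin (n + 1) → K)) * Nat.card (unitaryGrp q K n) := by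
  let := unitAction q K (n + 1)
  have := h.unitAction_isPretransitive (n := n + 1)
  let e₀ : {v : Fin (n + 1) → K // hermForm q v v = 1} :=
    ⟨Pi.single 0 1, by rw [h.hermForm_single, Pi.single_eq_same]⟩
  obtain ⟨Ψ, _⟩ := h.exists_equiv_stabilizer e₀ rfl
  rw [card_eq_card_mul_card_stabilizer e₀, numUnit_top_eq, Nat.card_congr Ψ]

lemma sum_numUnit_fixedSpace [Fintype (unitaryGrp q K n)] [Fintype (unitaryGrp q K (n + 1))]
    (f : ℕ → ℝ) :
    ∑ g : unitaryGrp q K (n + 1), f (fixedDim g.1) * numUnit q (fixedSpace g.1) =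
      numUnit q (⊤ : Submodule K (Fin (n + 1) → K)) *
        ∑ k : unitaryGrp q K n, f (fixedDim k.1 + 1) := by
  have := h.finite
  let := unitAction q K (n + 1)
  have := h.unitAction_isPretransitive (n := n + 1)
  let e₀ : {v : Fin (n + 1) → K // hermForm q v v = 1} :=
    ⟨Pi.single 0 1, by rw [h.hermForm_single, Pi.single_eq_same]⟩
  obtain ⟨Ψ, hΨ⟩ := h.exists_equiv_stabilizer e₀ rfl
  have := Fintype.ofFinite {v : Fin (n + 1) → K // hermForm q v v = 1}
  have := Fintype.ofFinite (MulAction.stabilizer (unitaryGrp q K (n + 1)) e₀)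
  have h1 := sum_mul_card_fixed (fun g : unitaryGrp q K (n + 1) => f (fixedDim g.1))
    (fun g k => by
      change f (fixedDim (k.1 * g.1 * k.1⁻¹)) = _
      rw [fixedDim_conj]) e₀
  rw [← numUnit_top_eq, ← Ψ.sum_comp] at h1
  simp only [hΨ] at h1
  rw [← h1]
  refine Finset.sum_congr rfl fun g _ => ?_
  congr 2
  refine Nat.card_congr ⟨fun w => ⟨⟨w.1, w.2.2⟩, Subtype.ext (mem_fixedSpace.1 w.2.1)⟩,
    fun v => ⟨v.1.1, mem_fixedSpace.2 (congrArg Subtype.val v.2), v.1.2⟩, fun _ => rfl,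
    fun _ => rfl⟩

/-! ### Moments and the distribution for the unitary group -/

lemma neg_pow_ne {i j : ℕ} (hij : i ≠ j) : (-(q : ℝ)) ^ i ≠ (-(q : ℝ)) ^ j := by
  intro hp
  have h1 := congrArg abs hp
  rw [abs_pow, abs_pow, abs_neg, Nat.abs_cast] at h1
  exact hij (pow_right_injective₀ (by exact_mod_cast h.q_ne_zero.bot_lt)
    (by exact_mod_cast h.one_lt.ne') h1)

/-- The moments of `(-q) ^ fixedDim g` of order up to `n` do not depend on `n`. -/
lemma sum_moment (n : ℕ) : ∀ [Fintype (unitaryGrp q K n)], ∀ j ≤ n,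
    ∑ g : unitaryGrp q K n, ((-(q : ℝ)) ^ fixedDim g.1) ^ j =
      szego (-(q : ℝ)) j 1 * Nat.card (unitaryGrp q K n) := by
  have := h.finite
  have hq0 : (q : ℝ) ≠ 0 := by exact_mod_cast h.q_ne_zero
  induction n with
  | zero =>
    intro _ j hj
    obtain rfl : j = 0 := by omega
    simp [szego]
  | succ n ih =>
    intro _ j
    have := Fintype.ofFinite (unitaryGrp q K n)
    have hS := h.mul_numUnit_top (n := n + 1)
    have hcard : (Nat.card (unitaryGrp q K (n + 1)) : ℝ) =
        numUnit q (⊤ : Submodule K (Fin (n + 1) → K)) * Nat.card (unitaryGrp q K n) := by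
      exact_mod_cast h.card_unitaryGrp_succ
    obtain ⟨x, hx⟩ : ∃ x, x = -(q : ℝ) := ⟨_, rfl⟩
    have hqx : (q : ℝ) = -x := by rw [hx, neg_neg]
    have hx0 : x ≠ 0 := by rw [hx]; exact neg_ne_zero.2 hq0
    have hne : ∀ {i j : ℕ}, i ≠ j → x ^ i ≠ x ^ j := by rw [hx]; exact h.neg_pow_ne
    have hsq : ∀ m : ℕ, (q : ℝ) ^ (2 * m) = (x ^ m) ^ 2 := by
      intro m
      rw [hqx, pow_mul, neg_sq, ← pow_mul, mul_comm, pow_mul]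
    rw [hsq, ← hx] at hS
    rw [← hx] at ih ⊢
    induction j using Nat.twoStepInduction with
    | zero => simp [szego]
    | one =>
      intro _
      have h1 := h.sum_numUnit_hermOrth (n := n + 1) (fun m => x ^ m)
      simp only [mul_sub, Finset.sum_sub_distrib, ← Finset.sum_mul] at h1
      have h2 : ∀ g : unitaryGrp q K (n + 1), x ^ (fixedDim g.1 + 1) *
          (numUnit q (hermOrth q (fixedSpace g.1)) : ℝ) =
            x * (x ^ fixedDim g.1 * numUnit q (hermOrth q (fixedSpace g.1))) := by
        intro g; ring
      rw [Finset.sum_congr rfl fun g _ => h2 g, ← Finset.mul_sum] at h1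
      have h3 : (q : ℝ) * numUnit q (⊤ : Submodule K (Fin (n + 1) → K)) ≠ 0 := by
        rw [hS, ← pow_mul]
        exact sub_ne_zero.2 (hne (by omega))
      have h4 : (q * numUnit q (⊤ : Submodule K (Fin (n + 1) → K)) : ℝ) *
          ∑ g : unitaryGrp q K (n + 1), x ^ fixedDim g.1 = 0 := by
        rw [hqx] at h1 ⊢
        linear_combination -h1
      simpa [szego, h3] using h4
    | more i ih0 _ =>
      intro hi
      have hi0 := ih0 (by omega)
      rw [szego_add_two_one]
      set s := szego x i 1
      set C := (Nat.card (unitaryGrp q K (n + 1)) : ℝ)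
      set S := (numUnit q (⊤ : Submodule K (Fin (n + 1) → K)) : ℝ)
      set y := ∑ g : unitaryGrp q K (n + 1), (x ^ fixedDim g.1) ^ (i + 2) with hy
      set a := ∑ g : unitaryGrp q K (n + 1), (x ^ fixedDim g.1) ^ (i + 2) *
        (numUnit q (hermOrth q (fixedSpace g.1)) : ℝ) with ha
      set B := ∑ g : unitaryGrp q K (n + 1), (x ^ fixedDim g.1) ^ i *
        (numUnit q (fixedSpace g.1) : ℝ) with hB
      have e1 : x ^ (i + 2) * a = q * (S * y - a) := by
        have h1 := h.sum_numUnit_hermOrth (n := n + 1) (fun m => (x ^ m) ^ (i + 2))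
        have h2 : ∀ g : unitaryGrp q K (n + 1), (x ^ (fixedDim g.1 + 1)) ^ (i + 2) *
            (numUnit q (hermOrth q (fixedSpace g.1)) : ℝ) = x ^ (i + 2) *
              ((x ^ fixedDim g.1) ^ (i + 2) * numUnit q (hermOrth q (fixedSpace g.1))) := by
          intro g; ring
        rw [ha, Finset.mul_sum, ← Finset.sum_congr rfl fun g _ => h2 g, h1, hy]
        congr 1
        rw [Finset.mul_sum, ← Finset.sum_sub_distrib]
        refine Finset.sum_congr rfl fun g _ => ?_
        ring
      have e2 : q * a = (x ^ (n + 1)) ^ 2 * (s * C) - x ^ (n + 1) * (y - q * B) := by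
        rw [← hi0, hy, hB, ha]
        simp only [Finset.mul_sum, ← Finset.sum_sub_distrib]
        refine Finset.sum_congr rfl fun g _ => ?_
        have h1 := h.mul_numUnit_hermOrth (fixedSpace g.1)
        rw [← fixedDim_eq, hsq, hsq, ← hx] at h1
        linear_combination (x ^ fixedDim g.1) ^ i * h1
      have e3 : B = x ^ i * (s * C) := by
        have h1 := h.sum_numUnit_fixedSpace (n := n) (fun m => (x ^ m) ^ i)
        have h2 := ih i (by omega)
        have h3 : ∑ k : unitaryGrp q K n, (x ^ (fixedDim k.1 + 1)) ^ i =
            x ^ i * ∑ k : unitaryGrp q K n, (x ^ fixedDim k.1) ^ i := by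
          rw [Finset.mul_sum]
          refine Finset.sum_congr rfl fun k _ => ?_
          ring
        rw [h3, h2] at h1
        rw [hB, h1, hcard]
        ring
      -- Eliminating `a` and `B` leaves an equation for `y` whose coefficient does not vanish, since
      -- `i + 1 < n + 1`.
      have hd : x ^ (n + 1) - x ^ (i + 1) ≠ 0 := sub_ne_zero.2 (hne (by omega))
      refine mul_left_cancel₀ hd (mul_left_cancel₀ (pow_ne_zero (n + 1 + 1) hx0) ?_)
      rw [e3, hqx] at e2
      rw [hqx] at e1 hS
      linear_combination -(x ^ (i + 2) - x) * e2 - x * e1 - x * y * hS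

lemma sum_unitary_powFalling [Fintype (unitaryGrp q K n)] {l : ℕ} (hl : l ≤ n) :
    ∑ g : unitaryGrp q K n, powFalling (-(q : ℝ)) ((-(q : ℝ)) ^ fixedDim g.1) l =
      (-1) ^ l * Nat.card (unitaryGrp q K n) :=
  sum_powFalling_of_moments _ (h.sum_moment n) hl

lemma card_unitary_eq_powFalling (k : ℕ) :
    (Nat.card (unitaryGrp q K k) : ℝ) = (-1) ^ k * powFalling (-(q : ℝ)) ((-(q : ℝ)) ^ k) k := by
  have := h.finite
  have := Fintype.ofFinite (unitaryGrp q K k)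
  refine card_eq_of_sum_powFalling_self (by norm_num) (fun g : unitaryGrp q K k => fixedDim g.1)
    (fun g => fixedDim_le g.1) 1 (fun g => ?_) (h.sum_unitary_powFalling le_rfl)
  rw [fixedDim_eq_top_iff, OneMemClass.coe_eq_one]

lemma fixedProb_unitary (n k : ℕ) :
    fixedProb (unitaryGrp q K n) k =
      1 / (Nat.card (unitaryGrp q K k) : ℝ) *
        ∑ i ∈ Finset.range (n + 1 - k),
          (-1 : ℝ) ^ i * (-(q : ℝ)) ^ (i.choose 2) /
            ((-(q : ℝ)) ^ (k * i) * (Nat.card (unitaryGrp q K i) : ℝ)) := by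
  have := h.finite
  have := Fintype.ofFinite (unitaryGrp q K n)
  have hx0 : -(q : ℝ) ≠ 0 := neg_ne_zero.2 (by exact_mod_cast h.q_ne_zero)
  have hx1 : ∀ i : ℕ, (-(q : ℝ)) ^ (i + 1) ≠ 1 := fun i => by
    rw [← pow_zero (-(q : ℝ))]
    exact h.neg_pow_ne (Nat.succ_ne_zero i)
  rw [fixedProb, card_eq_of_sum_powFalling hx0 hx1 (fun g : unitaryGrp q K n => fixedDim g.1)
    (fun g => fixedDim_le g.1) (-1) (fun l hl => h.sum_unitary_powFalling hl) k, Finset.mul_sum]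
  refine Finset.sum_congr rfl fun i _ => ?_
  rw [h.card_unitary_eq_powFalling, h.card_unitary_eq_powFalling]
  have hk := powFalling_self_ne_zero hx0 hx1 k
  have hi := powFalling_self_ne_zero hx0 hx1 i
  have h4 : (-(q : ℝ)) ^ (k * i) ≠ 0 := pow_ne_zero _ hx0
  have h5 : ∀ m : ℕ, ((-1 : ℝ) ^ m)⁻¹ = (-1) ^ m := fun m => by rw [← inv_pow]; norm_num
  simp only [div_eq_mul_inv, mul_inv, h5, one_mul]
  ring

end IsQuadraticField

end Stabilizer

theorem theorem4 (q : ℕ)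
    (F : Type*) [Field F] [Finite F] (hF : Nat.card F = q)
    (K : Type*) [Field K] [Finite K] (hK : Nat.card K = q ^ 2) :
    (∀ n k : ℕ,
      fixedProb (⊤ : Subgroup (GL (Fin n) F)) k =
        1 / (Nat.card (GL (Fin k) F) : ℝ) *
          ∑ i ∈ Finset.range (n + 1 - k),
            (-1 : ℝ) ^ i * (q : ℝ) ^ (i.choose 2) /
              ((q : ℝ) ^ (k * i) * (Nat.card (GL (Fin i) F) : ℝ))) ∧
    (Multipliable (fun r : ℕ => 1 - 1 / (q : ℝ) ^ (r + 1)) ∧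
      ∀ k : ℕ,
        Tendsto (fun n : ℕ => fixedProb (⊤ : Subgroup (GL (Fin n) F)) k) atTop
          (𝓝 ((∏' r : ℕ, (1 - 1 / (q : ℝ) ^ (r + 1))) *
            ((1 / (q : ℝ)) ^ (k ^ 2) /
              ∏ i ∈ Finset.Icc 1 k, (1 - 1 / (q : ℝ) ^ i) ^ 2)))) ∧
    (∀ n k : ℕ,
      fixedProb (unitaryGrp q K n) k =
        1 / (Nat.card (unitaryGrp q K k) : ℝ) *
          ∑ i ∈ Finset.range (n + 1 - k),
            (-1 : ℝ) ^ i * (-(q : ℝ)) ^ (i.choose 2) /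
              ((-(q : ℝ)) ^ (k * i) * (Nat.card (unitaryGrp q K i) : ℝ))) ∧
    (Multipliable (fun r : ℕ => 1 + 1 / (-(q : ℝ)) ^ (r + 1)) ∧
      ∀ k : ℕ,
        Tendsto (fun n : ℕ => fixedProb (unitaryGrp q K n) k) atTop
          (𝓝 ((∏' r : ℕ, (1 + 1 / (-(q : ℝ)) ^ (r + 1))) *
            ((1 / (q : ℝ)) ^ (k ^ 2) /
              ∏ i ∈ Finset.Icc 1 k, (1 - 1 / (q : ℝ) ^ (2 * i)))))) := by
  have h := isQuadraticField_of_card hF hK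
  subst hF
  have hq1 : 1 < (Nat.card F : ℝ) := by exact_mod_cast h.one_lt
  have hq0 : (Nat.card F : ℝ) ≠ 0 := by positivity
  have hIcc : ∀ (f : ℕ → ℝ) (k : ℕ),
      ∏ i ∈ Finset.Icc 1 k, f i = ∏ r ∈ Finset.range k, f (r + 1) := by
    intro f k
    rw [Finset.range_eq_Ico, Finset.prod_Ico_add' f 0 k 1]
    rfl
  have hGL : ∀ r : ℕ, 1 - 1 / (Nat.card F : ℝ) ^ (r + 1) =
      1 + -1 * (Nat.card F : ℝ)⁻¹ ^ (r + 1) := fun r => by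
    rw [inv_pow, one_div, neg_one_mul, sub_eq_add_neg]
  have hU : ∀ r : ℕ, 1 + 1 / (-(Nat.card F : ℝ)) ^ (r + 1) =
      1 + - -1 * (-(Nat.card F : ℝ))⁻¹ ^ (r + 1) := fun r => by
    rw [inv_pow, one_div, neg_neg, one_mul]
  have hlt : |(Nat.card F : ℝ)⁻¹| < 1 := by
    rw [abs_inv, Nat.abs_cast]
    exact inv_lt_one_of_one_lt₀ hq1
  refine ⟨fixedProb_GL, ⟨?_, fun k => ?_⟩, h.fixedProb_unitary, ⟨?_, fun k => ?_⟩⟩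
  · simp_rw [hGL]
    exact multipliable_one_add_mul_pow hlt
  · simp_rw [fixedProb_GL, hIcc, hGL]
    convert tendsto_finite_formula (x := (Nat.card F : ℝ)) (ε := 1) (by rwa [Nat.abs_cast])
      (by norm_num) (fun k => Nat.card (GL (Fin k) F)) (fun k => by
        rw [card_GL_eq_powFalling, one_pow, one_mul]) k using 3
    rw [← Finset.prod_mul_distrib, one_pow, one_mul, one_div_pow, div_div]
    congr 2
    refine Finset.prod_congr rfl fun r _ => ?_
    ring
  · simp_rw [hU]
    exact multipliable_one_add_mul_pow (by rwa [inv_neg, abs_neg])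
  · simp_rw [h.fixedProb_unitary, hIcc, hU]
    convert tendsto_finite_formula (x := -(Nat.card F : ℝ)) (ε := -1)
      (by rwa [abs_neg, Nat.abs_cast]) (by norm_num)
      (fun k => Nat.card (unitaryGrp (Nat.card F) K k))
      h.card_unitary_eq_powFalling k using 3
    have h1 : (-1 : ℝ) ^ k * (-(Nat.card F : ℝ)) ^ (k ^ 2) = (Nat.card F : ℝ) ^ (k ^ 2) := by
      have h2 : (-1 : ℝ) ^ (k ^ 2) = (-1) ^ k := by
        rcases Nat.even_or_odd k with hk | hk
        · rw [hk.neg_one_pow, (hk.pow_of_ne_zero two_ne_zero).neg_one_pow]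
        · rw [hk.neg_one_pow, hk.pow.neg_one_pow]
      rw [neg_pow (Nat.card F : ℝ), h2, ← mul_assoc, ← mul_pow]
      norm_num
    rw [h1, ← Finset.prod_mul_distrib, one_div_pow, div_div]
    congr 2
    refine Finset.prod_congr rfl fun r _ => ?_
    rw [pow_mul, ← neg_sq, ← pow_mul, mul_comm 2, pow_mul, inv_pow]
    ring
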